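/- Let $G$ be the group of real matrices $$\begin{pmatrix}1&x&z&0&0\\0&1&y&0&0\\0&0&1&0&0\\0&0&0&1&t\\0&0&0&0&1\end{pmatrix},\qquad x,y,z,t\in\mathbb R,$$ let $\Gamma\subset G$ be the subgroup of matrices with integral entries, acting by left multiplication, and let $M=\Gamma\backslash G$ (the Kodaira--Thurston manifold, a compact Hausdorff smooth $4$-manifold). The vector fields $e_1=\partial_t$, $e_2=\partial_x$, $e_3=\partial_y+x\,\partial_z$, $e_4=\partial_z$ on $G$ descend to a global frame of $M$. Let $\Delta=\{t\in\mathbb C:|t|<\pi\}$ with its standard complex structure, let $e_5=\partial/\partial\operatorname{Re}t$, $e_6=\partial/\partial\operatorname{Im}t$, and let $J$ be the endomorphism of the tangent bundle of $M\times\Delta$ whose matrix in the frame $e_1,\dots,e_6$ is $$\begin{pmatrix}0&-1&0&0&0&0\\1&0&0&0&0&0\\0&0&-\frac{\operatorname{Im}t}{\operatorname{Re}t+\pi}&-\frac{|t+\pi|^2}{\operatorname{Re}t+\pi}&0&0\\0&0&\frac1{\operatorname{Re}t+\pi}&\frac{\operatorname{Im}t}{\operatorname{Re}t+\pi}&0&0\\0&0&0&0&0&-1\\0&0&0&0&1&0\end{pmatrix}.$$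 For an almost complex manifold $X$ of complex dimension $n$ with canonical bundle $\omega_X=\Lambda^{n,0}T^*X$, the operator $\bar\partial$ on $(n,0)$-forms is the $(n,1)$-part of $d$; it is extended to $\omega_X^{\otimes m}$ by the Leibniz rule. Put $P_m(X)=\dim_{\mathbb C}\{\varphi \text{ a smooth section of }\omega_X^{\otimes m}:\bar\partial\varphi=0\}$, and let $\operatorname{kod}(X)=-\infty$ if $P_m(X)=0$ for all $m\ge1$ and $\operatorname{kod}(X)=\limsup_{m\to\infty}\frac{\log P_m(X)}{\log m}$ otherwise (with $\log 0=-\infty$). Then: 1. $J$ is an almost complex structure on $M\times\Delta$ (it is smooth and $J^2=-\mathrm{id}$), and the projection $M\times\Delta\to\Delta$ is pseudoholomorphic (it is smooth and its differential commutes with the almost complex structures). 2. For every $t\in\Delta$, $J$ restricts to an almost complex structure $J_t$ on the fibre $M_t=M\times\{t\}$, so that the inclusion $M_t\to M\times\Delta$ is pseudoholomorphic. 3. For every real $t$ with $|t|<\pi$, $\operatorname{kod}(M_t,J_t)=-\infty$ if $t\notin\pi\mathbb Q$, and $\operatorname{kod}(M_t,J_t)=0$ if $t\in\pi\mathbb Q$.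 4. For every $m\ge1$, the plurigenus $P_m(M_t,J_t)$ is finite for all $t\in\Delta$ and is an upper semicontinuous function of $t\in\Delta$. 5. The function $t\mapsto\operatorname{kod}(M_t,J_t)$ on $\Delta$ is neither upper nor lower semicontinuous. More precisely, its restriction to the real interval $(-\pi,\pi)$ is not upper semicontinuous at any $t\notin\pi\mathbb Q$ and not lower semicontinuous at any $t\in\pi\mathbb Q$. -/

import Mathlib

open scoped Manifold ContDiff Topology
open Set

noncomputable section

/-! ## Almost complex manifolds -/

namespace AlmostComplex

section General

variable {E : Type*} [NormedAddCommGroup E] [NormedSpace ℝ E]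
  {H : Type*} [TopologicalSpace H] (I : ModelWithCorners ℝ E H)
  {M : Type*} [TopologicalSpace M] [ChartedSpace H M]
  {E' : Type*} [NormedAddCommGroup E'] [NormedSpace ℝ E']
  {H' : Type*} [TopologicalSpace H'] (I' : ModelWithCorners ℝ E' H')
  {M' : Type*} [TopologicalSpace M'] [ChartedSpace H' M']

/-- `J` is an almost complex structure on the smooth manifold `M`: a smooth bundle endomorphism
`J : TM → TM` with `J² = -id`. -/
structure IsAlmostComplexStructure [IsManifold I 1 M]
    (J : ∀ x : M, TangentSpace I x →L[ℝ] TangentSpace I x) : Prop where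
  sq_eq_neg : ∀ (x : M) (v : TangentSpace I x), J x (J x v) = -v
  smooth : ContMDiff I.tangent I.tangent ∞
    (fun v : TangentBundle I M => (⟨v.1, J v.1 v.2⟩ : TangentBundle I M))

/-- A map between almost complex manifolds is pseudoholomorphic if it is smooth and
its differential commutes with the almost complex structures. -/
structure IsPseudoholomorphic
    (J : ∀ x : M, TangentSpace I x →L[ℝ] TangentSpace I x)
    (J' : ∀ x : M', TangentSpace I' x →L[ℝ] TangentSpace I' x) (f : M → M') : Prop where
  smooth : ContMDiff I I' ∞ f
  comm : ∀ (x : M) (v : TangentSpace I x),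
    mfderiv I I' f x (J x v) = J' (f x) (mfderiv I I' f x v)

end General

/-! ## Pluricanonical sections and Kodaira dimension

The manifold `M` is modelled on the real normed space `E` (no boundary). Complex valued `k`-forms
are alternating real multilinear forms on the (real) tangent spaces with values in `ℂ`; they are
the same thing as complex alternating forms on the complexified tangent spaces. -/

section Forms

variable {E : Type*} [NormedAddCommGroup E] [NormedSpace ℝ E]
  {M : Type*} [TopologicalSpace M] [ChartedSpace E M]

/-- The fibre at `x` of the bundle of complex valued `k`-forms. -/
abbrev FormFibre (E : Type*) [NormedAddCommGroup E] [NormedSpace ℝ E]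
    {M : Type*} [TopologicalSpace M] [ChartedSpace E M] (k : ℕ) (x : M) : Type _ :=
  (TangentSpace 𝓘(ℝ, E) x) [⋀^Fin k]→L[ℝ] ℂ

/-- The coordinate expression of a form in the chart at `x₀`: its pull-back along the inverse
of the chart. -/
def formInChart {k : ℕ} (ψ : ∀ x : M, FormFibre E k x) (x₀ : M) (y : E) : E [⋀^Fin k]→L[ℝ] ℂ :=
  (ψ ((extChartAt 𝓘(ℝ, E) x₀).symm y)).compContinuousLinearMap
    (mfderiv 𝓘(ℝ, E) 𝓘(ℝ, E) (extChartAt 𝓘(ℝ, E) x₀).symm y)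

/-- Smoothness of a form on an open set `U`, i.e. smoothness of its coordinate expressions. -/
def IsSmoothFormOn {k : ℕ} (ψ : ∀ x : M, FormFibre E k x) (U : Set M) : Prop :=
  ∀ x₀ : M, ContDiffOn ℝ ∞ (formInChart ψ x₀)
    ((extChartAt 𝓘(ℝ, E) x₀).target ∩ (extChartAt 𝓘(ℝ, E) x₀).symm ⁻¹' U)

/-- The exterior differential of a form at the point `x`, computed in the chart at `x`. -/
def extDerivAt {k : ℕ} (ψ : ∀ x : M, FormFibre E k x) (x : M) : FormFibre E (k + 1) x :=
  (extDeriv (formInChart ψ x) (extChartAt 𝓘(ℝ, E) x x)).compContinuousLinearMap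
    (mfderiv 𝓘(ℝ, E) 𝓘(ℝ, E) (extChartAt 𝓘(ℝ, E) x) x)

variable (J : ∀ x : M, TangentSpace 𝓘(ℝ, E) x →L[ℝ] TangentSpace 𝓘(ℝ, E) x)

/-- A `k`-form at `x` is of type `(k, 0)` if it is `J`-complex linear in each variable. -/
def IsTypeZero {k : ℕ} (x : M) (A : FormFibre E k x) : Prop :=
  ∀ (w : Fin k → TangentSpace 𝓘(ℝ, E) x) (i : Fin k),
    A (Function.update w i (J x (w i))) = Complex.I * A w

/-- The underlying multilinear map of the component of type `(k, 0)`: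
`A ↦ A(w₁^{1,0}, …, w_k^{1,0})` where `w^{1,0} = (w - i J w) / 2` and `A` is extended complex
linearly to the complexified tangent space, expanded by multilinearity. -/
def projMultilinear {k : ℕ} (x : M) (A : FormFibre E k x) :
    ContinuousMultilinearMap ℝ (fun _ : Fin k => TangentSpace 𝓘(ℝ, E) x) ℂ :=
  ∑ S : Finset (Fin k), ((1 / 2 : ℂ) ^ k * (-Complex.I) ^ S.card) •
    A.toContinuousMultilinearMap.compContinuousLinearMap
      (fun i => if i ∈ S then J x else ContinuousLinearMap.id ℝ _)

theorem projMultilinear_apply {k : ℕ} (x : M) (A : FormFibre E k x)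
    (w : Fin k → TangentSpace 𝓘(ℝ, E) x) :
    projMultilinear J x A w = ∑ S : Finset (Fin k), ((1 / 2 : ℂ) ^ k * (-Complex.I) ^ S.card) *
      A (fun i => if i ∈ S then J x (w i) else w i) := by
  simp only [projMultilinear, _root_.sum_apply, _root_.smul_apply, smul_eq_mul,
    ContinuousMultilinearMap.compContinuousLinearMap_apply]
  refine Finset.sum_congr rfl fun S _ => ?_
  congr 1
  change A _ = A _
  congr 1
  funext i
  split_ifs <;> rfl

/-- The component of type `(k, 0)` of a complex valued `k`-form at `x`. -/
def projTypeZero {k : ℕ} (x : M) (A : FormFibre E k x) : FormFibre E k x :=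
  { projMultilinear J x A with
    map_eq_zero_of_eq' := by
      intro w i j hw hij
      change projMultilinear J x A w = 0
      have h1 : projMultilinear J x A w = -projMultilinear J x A w := by
        conv_lhs => rw [projMultilinear_apply]
        rw [projMultilinear_apply, ← Finset.sum_neg_distrib]
        refine Fintype.sum_equiv (Equiv.swap i j).finsetCongr _ _ fun S => ?_
        have h2 : (fun l => if l ∈ (Equiv.swap i j).finsetCongr S then J x (w l) else w l) =
            (fun l => if l ∈ S then J x (w l) else w l) ∘ Equiv.swap i j := by
          funext l
          have h3 : w (Equiv.swap i j l) = w l := by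
            rcases eq_or_ne l i with rfl | hi
            · rw [Equiv.swap_apply_left, hw]
            · rcases eq_or_ne l j with rfl | hj
              · rw [Equiv.swap_apply_right, hw]
              · rw [Equiv.swap_apply_of_ne_of_ne hi hj]
          have h4 : l ∈ (Equiv.swap i j).finsetCongr S ↔ Equiv.swap i j l ∈ S := by
            simp [Equiv.finsetCongr, Finset.mem_map_equiv]
          simp only [Function.comp, h3, h4]
        rw [h2]
        have h5 := A.toAlternatingMap.map_swap (fun l => if l ∈ S then J x (w l) else w l) hij
        have h6 : A ((fun l => if l ∈ S then J x (w l) else w l) ∘ Equiv.swap i j) =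
          -A (fun l => if l ∈ S then J x (w l) else w l) := h5
        rw [h6]
        simp [Equiv.finsetCongr]
      exact self_eq_neg.mp h1 }

/-- The operator `∂̄` on forms of type `(n, 0)`. The `(n, 1)`-form `∂̄ψ = (dψ)^{n,1}` is regarded
as a `(0, 1)`-form with values in the canonical bundle through `α ⊗ φ ↔ α ∧ φ`; its value on the
tangent vector `v` is `dψ(v^{0,1}, ·^{1,0}, …, ·^{1,0})` with `v^{0,1} = (v + i J v) / 2`. -/
def dbarForm {n : ℕ} (ψ : ∀ x : M, FormFibre E n x) (x : M) (v : TangentSpace 𝓘(ℝ, E) x) :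
    FormFibre E n x :=
  let η : E [⋀^Fin (n + 1)]→L[ℝ] ℂ := extDerivAt ψ x
  projTypeZero J x ((1 / 2 : ℂ) • (η.curryLeft v + Complex.I • η.curryLeft (J x v)))

/-- The differential at `x` of a complex valued function on `M`. -/
def diffFun (f : M → ℂ) (x : M) : TangentSpace 𝓘(ℝ, E) x →L[ℝ] ℂ :=
  mfderiv 𝓘(ℝ, E) 𝓘(ℝ, ℂ) f x

/-- The operator `∂̄` on functions: `∂̄f(v) = df(v^{0,1})`. -/
def dbarFun (f : M → ℂ) (x : M) (v : TangentSpace 𝓘(ℝ, E) x) : ℂ :=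
  (1 / 2 : ℂ) * (diffFun f x v + Complex.I * diffFun f x (J x v))

theorem dbarFun_zero (x : M) (v : TangentSpace 𝓘(ℝ, E) x) :
    dbarFun J (fun _ => (0 : ℂ)) x v = 0 := by
  have h : ∀ u : TangentSpace 𝓘(ℝ, E) x, diffFun (fun _ => (0 : ℂ)) x u = 0 := by
    intro u
    rw [diffFun, mfderiv_const]
    rfl
  simp [dbarFun, h]

theorem dbarFun_add {f g : M → ℂ} {x : M} (hf : MDifferentiableAt 𝓘(ℝ, E) 𝓘(ℝ, ℂ) f x)
    (hg : MDifferentiableAt 𝓘(ℝ, E) 𝓘(ℝ, ℂ) g x) (v : TangentSpace 𝓘(ℝ, E) x) :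
    dbarFun J (f + g) x v = dbarFun J f x v + dbarFun J g x v := by
  have h : ∀ u : TangentSpace 𝓘(ℝ, E) x,
      diffFun (f + g) x u = diffFun f x u + diffFun g x u := by
    intro u
    rw [diffFun, mfderiv_add hf hg]
    rfl
  simp only [dbarFun, h]
  ring

theorem dbarFun_const_mul (c : ℂ) {f : M → ℂ} {x : M}
    (hf : MDifferentiableAt 𝓘(ℝ, E) 𝓘(ℝ, ℂ) f x) (v : TangentSpace 𝓘(ℝ, E) x) :
    dbarFun J (fun y => c * f y) x v = c * dbarFun J f x v := by
  have h1 : HasMFDerivAt 𝓘(ℝ, E) 𝓘(ℝ, ℂ) (fun y => c * f y) x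
      (c • (show E →L[ℝ] ℂ from mfderiv 𝓘(ℝ, E) 𝓘(ℝ, ℂ) f x)) :=
    ⟨continuousAt_const.mul hf.continuousAt, hf.hasMFDerivAt.2.const_mul c⟩
  have h : ∀ u : TangentSpace 𝓘(ℝ, E) x,
      diffFun (fun y => c * f y) x u = c * diffFun f x u := by
    intro u
    rw [diffFun, h1.mfderiv]
    rfl
  simp only [dbarFun, h]
  ring

/-- The fibre at `x` of the `m`-th tensor power (over `ℂ`) of the bundle of complex valued
`n`-forms. The fibre at `x` of the `m`-canonical bundle `ω^{⊗m}` is the line in it that is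
spanned by `φ ⊗ … ⊗ φ` for a nonzero `φ` of type `(n, 0)` at `x`, when `dim_ℝ M = 2n`. -/
abbrev TensorFibre (E : Type*) [NormedAddCommGroup E] [NormedSpace ℝ E]
    {M : Type*} [TopologicalSpace M] [ChartedSpace E M] (n m : ℕ) (x : M) : Type _ :=
  PiTensorProduct ℂ (fun _ : Fin m => FormFibre E n x)

/-- The section `ψ ⊗ … ⊗ ψ` (`m` factors). -/
def formPow {n : ℕ} (m : ℕ) (ψ : ∀ x : M, FormFibre E n x) (x : M) : TensorFibre E n m x :=
  PiTensorProduct.tprod ℂ (fun _ : Fin m => ψ x)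

/-- `∂̄(ψ ⊗ … ⊗ ψ) = ∑ᵢ ψ ⊗ … ⊗ ∂̄ψ ⊗ … ⊗ ψ`, with `∂̄ψ` in the `i`-th place, evaluated on `v`. -/
def dbarFormPow {n : ℕ} (m : ℕ) (ψ : ∀ x : M, FormFibre E n x) (x : M)
    (v : TangentSpace 𝓘(ℝ, E) x) : TensorFibre E n m x :=
  ∑ i : Fin m, PiTensorProduct.tprod ℂ
    (Function.update (fun _ : Fin m => ψ x) i (dbarForm J ψ x v))

/-- `ψ` is a local smooth frame over `U` of the canonical bundle of `(M, J)`, `dim_ℝ M = 2n`: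
a smooth nowhere vanishing form of type `(n, 0)` on `U`. -/
structure IsCanonicalFrameOn {n : ℕ} (ψ : ∀ x : M, FormFibre E n x) (U : Set M) : Prop where
  smooth : IsSmoothFormOn ψ U
  type_zero : ∀ x ∈ U, IsTypeZero J x (ψ x)
  ne_zero : ∀ x ∈ U, ψ x ≠ 0

/-- The section `σ` of `ω^{⊗m}` is smooth and satisfies `∂̄σ = 0` on `U`, expressed in the frame
`ψ`: `σ = f · ψ^{⊗m}` with `f` smooth, and `∂̄f ⊗ ψ^{⊗m} + f · ∂̄(ψ^{⊗m}) = 0`. -/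
def IsPseudoholomorphicInFrame {n m : ℕ} (ψ : ∀ x : M, FormFibre E n x) (U : Set M)
    (σ : ∀ x : M, TensorFibre E n m x) : Prop :=
  ∃ f : M → ℂ, ContMDiffOn 𝓘(ℝ, E) 𝓘(ℝ, ℂ) ∞ f U ∧ ∀ x ∈ U,
    σ x = f x • formPow m ψ x ∧
    ∀ v : TangentSpace 𝓘(ℝ, E) x,
      dbarFun J f x v • formPow m ψ x + f x • dbarFormPow J m ψ x v = 0

/-- The complex vector space `H⁰(X, ω_X^{⊗m})` of pseudoholomorphic `m`-canonical sections of the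
almost complex manifold `X = (M, J)` of complex dimension `n`: sections of `ω_X^{⊗m}` which are
smooth and killed by `∂̄`, in terms of every local frame of the canonical bundle. -/
def pluricanonicalSections (n m : ℕ) : Submodule ℂ (∀ x : M, TensorFibre E n m x) where
  carrier := {σ | ∀ (U : Set M) (ψ : ∀ x : M, FormFibre E n x), IsOpen U →
    IsCanonicalFrameOn J ψ U → IsPseudoholomorphicInFrame J ψ U σ}
  zero_mem' := by
    intro U ψ _ _
    refine ⟨fun _ => 0, contMDiffOn_const, fun x _ => ⟨by simp, fun v => ?_⟩⟩
    rw [dbarFun_zero, zero_smul, zero_smul, add_zero]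
  add_mem' := by
    intro σ τ hσ hτ U ψ hU hψ
    obtain ⟨f, hf, hf'⟩ := hσ U ψ hU hψ
    obtain ⟨g, hg, hg'⟩ := hτ U ψ hU hψ
    refine ⟨f + g, hf.add hg, fun x hx => ⟨?_, fun v => ?_⟩⟩
    · rw [Pi.add_apply, Pi.add_apply, (hf' x hx).1, (hg' x hx).1, add_smul]
    · rw [dbarFun_add J ((hf.contMDiffAt (hU.mem_nhds hx)).mdifferentiableAt (by simp))
        ((hg.contMDiffAt (hU.mem_nhds hx)).mdifferentiableAt (by simp)),
        Pi.add_apply, add_smul, add_smul, add_add_add_comm, (hf' x hx).2 v, (hg' x hx).2 v,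
        add_zero]
  smul_mem' := by
    intro c σ hσ U ψ hU hψ
    obtain ⟨f, hf, hf'⟩ := hσ U ψ hU hψ
    refine ⟨fun x => c * f x, ?_, fun x hx => ⟨?_, fun v => ?_⟩⟩
    · exact ((contDiff_const (c := c)).mul contDiff_id).contMDiff.comp_contMDiffOn hf
    · rw [Pi.smul_apply, (hf' x hx).1, smul_smul]
    · rw [dbarFun_const_mul J c ((hf.contMDiffAt (hU.mem_nhds hx)).mdifferentiableAt (by simp)),
        mul_smul, mul_smul, ← smul_add, (hf' x hx).2 v, smul_zero]

/-- The `m`-th plurigenus of the almost complex manifold `(M, J)` of complex dimension `n`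
(meaningful when `H⁰(X, ω_X^{⊗m})` is finite dimensional, as it is on compact manifolds). -/
def plurigenus (n m : ℕ) : ℕ := Module.finrank ℂ (pluricanonicalSections J n m)

open Classical in
/-- The Kodaira dimension of the almost complex manifold `(M, J)` of complex dimension `n`:
`-∞` if all plurigenera with `m ≥ 1` vanish, `limsup_m log P_m / log m` otherwise
(with `log 0 = -∞`). -/
def kodairaDim (n : ℕ) : EReal :=
  if ∀ m : ℕ, 1 ≤ m → plurigenus J n m = 0 then ⊥
  else Filter.limsup
    (fun m : ℕ => ENNReal.log (plurigenus J n m : ENNReal) / ((Real.log m : ℝ) : EReal))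
    Filter.atTop

end Forms

end AlmostComplex

/-! ## The Kodaira–Thurston manifold -/

namespace KodairaThurston

/-- The matrix with coordinates `p = (x, y, z, t)`. -/
def mat (p : Fin 4 → ℝ) : Matrix (Fin 5) (Fin 5) ℝ :=
  !![1, p 0, p 2, 0, 0;
     0, 1, p 1, 0, 0;
     0, 0, 1, 0, 0;
     0, 0, 0, 1, p 3;
     0, 0, 0, 0, 1]

theorem det_mat (p : Fin 4 → ℝ) : (mat p).det = 1 := by
  simp [mat, Matrix.det_succ_row_zero, Fin.sum_univ_succ, Fin.succAbove]

/-- The coordinates `(x, y, z, t)` of the product of two matrices. -/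
def coordMul (p q : Fin 4 → ℝ) : Fin 4 → ℝ :=
  ![p 0 + q 0, p 1 + q 1, p 2 + q 2 + p 0 * q 1, p 3 + q 3]

theorem mat_mul (p q : Fin 4 → ℝ) : mat p * mat q = mat (coordMul p q) := by
  ext i j
  fin_cases i <;> fin_cases j <;>
    simp [mat, coordMul, Matrix.mul_apply, Fin.sum_univ_succ] <;> ring

theorem mat_zero : mat 0 = 1 := by
  ext i j
  fin_cases i <;> fin_cases j <;> simp [mat]

theorem mat_injective : Function.Injective mat := by
  intro p q h
  funext i
  fin_cases i
  · simpa [mat] using congrFun (congrFun h 0) 1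
  · simpa [mat] using congrFun (congrFun h 1) 2
  · simpa [mat] using congrFun (congrFun h 0) 2
  · simpa [mat] using congrFun (congrFun h 3) 4

/-- The coordinates of the inverse matrix. -/
def coordInv (p : Fin 4 → ℝ) : Fin 4 → ℝ := ![-p 0, -p 1, -p 2 + p 0 * p 1, -p 3]

theorem coordMul_coordInv (p : Fin 4 → ℝ) : coordMul p (coordInv p) = 0 := by
  funext i
  fin_cases i <;> simp [coordMul, coordInv]

/-- The matrix with coordinates `p` as an element of `SL(5, ℝ)`. -/
def matSL (p : Fin 4 → ℝ) : Matrix.SpecialLinearGroup (Fin 5) ℝ := ⟨mat p, det_mat p⟩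

theorem matSL_mul (p q : Fin 4 → ℝ) : matSL p * matSL q = matSL (coordMul p q) :=
  Subtype.ext (mat_mul p q)

theorem matSL_zero : matSL 0 = 1 := Subtype.ext mat_zero

theorem matSL_inv (p : Fin 4 → ℝ) : (matSL p)⁻¹ = matSL (coordInv p) :=
  inv_eq_of_mul_eq_one_right (by rw [matSL_mul, coordMul_coordInv, matSL_zero])

/-- The Lie group `G` of all matrices `mat (x, y, z, t)`. -/
def G : Subgroup (Matrix.SpecialLinearGroup (Fin 5) ℝ) where
  carrier := range matSL
  mul_mem' := by
    rintro _ _ ⟨p, rfl⟩ ⟨q, rfl⟩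
    exact ⟨_, (matSL_mul p q).symm⟩
  one_mem' := ⟨0, matSL_zero⟩
  inv_mem' := by
    rintro _ ⟨p, rfl⟩
    exact ⟨_, (matSL_inv p).symm⟩

/-- The element of `G` with coordinates `p = (x, y, z, t)`. -/
def toG (p : Fin 4 → ℝ) : G := ⟨matSL p, p, rfl⟩

theorem toG_mul (p q : Fin 4 → ℝ) : toG p * toG q = toG (coordMul p q) :=
  Subtype.ext (matSL_mul p q)

theorem toG_inv (p : Fin 4 → ℝ) : (toG p)⁻¹ = toG (coordInv p) := Subtype.ext (matSL_inv p)

theorem toG_zero : toG 0 = 1 := Subtype.ext matSL_zero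

theorem toG_surjective : Function.Surjective toG := by
  rintro ⟨_, p, rfl⟩
  exact ⟨p, rfl⟩

theorem toG_injective : Function.Injective toG := by
  intro p q h
  exact mat_injective (congrArg (fun g : G => (g.1.1 : Matrix (Fin 5) (Fin 5) ℝ)) h)

/-- A matrix with integral entries. -/
def IsIntegral (g : G) : Prop :=
  ∀ i j, ∃ k : ℤ, (g.1.1 : Matrix (Fin 5) (Fin 5) ℝ) i j = k

theorem isIntegral_toG_iff (p : Fin 4 → ℝ) :
    IsIntegral (toG p) ↔ ∀ i, ∃ k : ℤ, p i = k := by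
  constructor
  · intro h i
    fin_cases i
    · simpa [toG, matSL, mat] using h 0 1
    · simpa [toG, matSL, mat] using h 1 2
    · simpa [toG, matSL, mat] using h 0 2
    · simpa [toG, matSL, mat] using h 3 4
  · intro h i j
    have h0 : ∃ k : ℤ, (0 : ℝ) = k := ⟨0, by simp⟩
    have h1 : ∃ k : ℤ, (1 : ℝ) = k := ⟨1, by simp⟩
    fin_cases i <;> fin_cases j <;>
      first
        | exact h 0 | exact h 1 | exact h 2 | exact h 3 | exact h0 | exact h1

/-- The lattice `Γ` of matrices in `G` with integral entries. -/
def Γ : Subgroup G where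
  carrier := {g | IsIntegral g}
  mul_mem' := by
    intro a b ha hb
    obtain ⟨p, rfl⟩ := toG_surjective a
    obtain ⟨q, rfl⟩ := toG_surjective b
    have ha' := (isIntegral_toG_iff p).1 ha
    have hb' := (isIntegral_toG_iff q).1 hb
    choose m hm using ha'
    choose n hn using hb'
    change IsIntegral _
    rw [toG_mul, isIntegral_toG_iff]
    intro i
    fin_cases i
    · exact ⟨m 0 + n 0, by simp [coordMul, hm, hn]⟩
    · exact ⟨m 1 + n 1, by simp [coordMul, hm, hn]⟩
    · exact ⟨m 2 + n 2 + m 0 * n 1, by simp [coordMul, hm, hn]⟩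
    · exact ⟨m 3 + n 3, by simp [coordMul, hm, hn]⟩
  one_mem' := by
    change IsIntegral _
    rw [← toG_zero, isIntegral_toG_iff]
    exact fun _ => ⟨0, by simp⟩
  inv_mem' := by
    intro a ha
    obtain ⟨p, rfl⟩ := toG_surjective a
    have ha' := (isIntegral_toG_iff p).1 ha
    choose m hm using ha'
    change IsIntegral _
    rw [toG_inv, isIntegral_toG_iff]
    intro i
    fin_cases i
    · exact ⟨-m 0, by simp [coordInv, hm]⟩
    · exact ⟨-m 1, by simp [coordInv, hm]⟩
    · exact ⟨-m 2 + m 0 * m 1, by simp [coordInv, hm]⟩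
    · exact ⟨-m 3, by simp [coordInv, hm]⟩

/-- The Kodaira–Thurston manifold `M = Γ \ G`, the quotient of `G` by left multiplication by
elements of `Γ`, with the quotient topology. -/
def KT : Type := Quotient (MulAction.orbitRel Γ G)

instance : TopologicalSpace KT :=
  inferInstanceAs (TopologicalSpace (Quotient (MulAction.orbitRel Γ G)))

/-- The covering `ℝ⁴ ≅ G → Γ \ G`. -/
def proj (p : Fin 4 → ℝ) : KT := Quotient.mk (MulAction.orbitRel Γ G) (toG p)

theorem proj_surjective : Function.Surjective proj := by
  intro m
  obtain ⟨g, rfl⟩ := Quotient.exists_rep m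
  obtain ⟨p, rfl⟩ := toG_surjective g
  exact ⟨p, rfl⟩

theorem proj_eq_iff (p q : Fin 4 → ℝ) :
    proj p = proj q ↔ ∃ k : Fin 4 → ℤ, p = coordMul (fun i => (k i : ℝ)) q := by
  have h : proj p = proj q ↔ toG p ∈ MulAction.orbit Γ (toG q) :=
    Quotient.eq (r := MulAction.orbitRel Γ G)
  rw [h]
  constructor
  · rintro ⟨⟨g, hg⟩, hgq⟩
    obtain ⟨r, rfl⟩ := toG_surjective g
    obtain ⟨k, hk⟩ := Classical.axiomOfChoice ((isIntegral_toG_iff r).1 hg)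
    refine ⟨k, toG_injective ?_⟩
    have h1 : toG r * toG q = toG p := hgq
    rw [← h1, toG_mul]
    congr 2
    funext i
    exact hk i
  · rintro ⟨k, rfl⟩
    refine ⟨⟨toG (fun i => (k i : ℝ)), (isIntegral_toG_iff _).2 fun i => ⟨k i, rfl⟩⟩, ?_⟩
    exact toG_mul _ _

theorem continuous_toG : Continuous toG := by
  refine Continuous.subtype_mk (Continuous.subtype_mk ?_ _) _
  refine continuous_matrix fun i j => ?_
  fin_cases i <;> fin_cases j <;> simp [mat] <;> fun_prop

/-- The coordinates `(x, y, z, t)` of an element of `G`. -/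
def coords (g : G) : Fin 4 → ℝ := ![g.1.1 0 1, g.1.1 1 2, g.1.1 0 2, g.1.1 3 4]

theorem continuous_coords : Continuous coords := by
  have h : ∀ i j, Continuous (fun g : G => (g.1.1 : Matrix (Fin 5) (Fin 5) ℝ) i j) := fun i j =>
    (continuous_id.matrix_elem i j).comp (continuous_subtype_val.comp continuous_subtype_val)
  refine continuous_pi fun i => ?_
  fin_cases i
  · exact h 0 1
  · exact h 1 2
  · exact h 0 2
  · exact h 3 4

theorem coords_toG (p : Fin 4 → ℝ) : coords (toG p) = p := by
  funext i
  fin_cases i <;> simp [coords, toG, matSL, mat]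

theorem toG_coords (g : G) : toG (coords g) = g := by
  obtain ⟨p, rfl⟩ := toG_surjective g
  rw [coords_toG]

/-- The global chart `(x, y, z, t)` of `G`. -/
def homeoG : (Fin 4 → ℝ) ≃ₜ G where
  toFun := toG
  invFun := coords
  left_inv := coords_toG
  right_inv := toG_coords
  continuous_toFun := continuous_toG
  continuous_invFun := continuous_coords

theorem continuous_proj : Continuous proj :=
  (continuous_quot_mk (r := (MulAction.orbitRel Γ G).r)).comp continuous_toG

theorem isOpenMap_proj : IsOpenMap proj :=
  (isOpenMap_quotient_mk'_mul (Γ := Γ) (T := G)).comp homeoG.isOpenMap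

/-- The projection is injective on the unit cube with centre `c`. -/
theorem injOn_proj (c : Fin 4 → ℝ) : InjOn proj (Metric.ball c (1 / 2)) := by
  intro p hp q hq h
  obtain ⟨k, rfl⟩ := (proj_eq_iff p q).1 h
  rw [Metric.mem_ball, dist_pi_lt_iff (by norm_num)] at hp hq
  have key : ∀ i : Fin 4, |coordMul (fun i => (k i : ℝ)) q i - q i| < 1 := by
    intro i
    have h1 := hp i
    have h2 := hq i
    rw [Real.dist_eq, abs_lt] at h1 h2
    rw [abs_lt]
    constructor <;> linarith [h1.1, h1.2, h2.1, h2.2]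
  have hk : ∀ a : ℤ, |(a : ℝ)| < 1 → a = 0 := by
    intro a ha
    have : |a| < 1 := by exact_mod_cast ha
    exact Int.abs_lt_one_iff.1 this
  have k0 : k 0 = 0 := hk _ (by simpa [coordMul] using key 0)
  have k1 : k 1 = 0 := hk _ (by simpa [coordMul] using key 1)
  have k2 : k 2 = 0 := hk _ (by simpa [coordMul, k0] using key 2)
  have k3 : k 3 = 0 := hk _ (by simpa [coordMul] using key 3)
  funext i
  fin_cases i <;> simp [coordMul, k0, k1, k2, k3]

/-- The chart of `M` given by the coordinates `(x, y, z, t)` in the unit cube with centre `c`. -/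
def chart (c : Fin 4 → ℝ) : OpenPartialHomeomorph KT (Fin 4 → ℝ) :=
  (OpenPartialHomeomorph.ofContinuousOpen ((injOn_proj c).toPartialEquiv proj (Metric.ball c (1 / 2)))
    continuous_proj.continuousOn isOpenMap_proj Metric.isOpen_ball).symm

theorem chart_symm_apply (c p : Fin 4 → ℝ) : (chart c).symm p = proj p := rfl

theorem chart_target (c : Fin 4 → ℝ) : (chart c).target = Metric.ball c (1 / 2) := rfl

theorem chart_source (c : Fin 4 → ℝ) : (chart c).source = proj '' Metric.ball c (1 / 2) := rfl

theorem proj_chart (c : Fin 4 → ℝ) {m : KT} (hm : m ∈ (chart c).source) :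
    proj (chart c m) = m := (chart c).left_inv hm

/-- A point of `G`, in coordinates, above the given point of `M`. -/
def lift (m : KT) : Fin 4 → ℝ := (proj_surjective m).choose

theorem proj_lift (m : KT) : proj (lift m) = m := (proj_surjective m).choose_spec

instance : ChartedSpace (Fin 4 → ℝ) KT where
  atlas := range chart
  chartAt m := chart (lift m)
  mem_chart_source m := by
    rw [chart_source]
    exact ⟨lift m, Metric.mem_ball_self (by norm_num), proj_lift m⟩
  chart_mem_atlas m := ⟨lift m, rfl⟩

/-- Integer valued functions which are continuous within a set at a point are constant near it. -/
theorem eventually_eq_of_int {s : Set (Fin 4 → ℝ)} {p : Fin 4 → ℝ} {g : (Fin 4 → ℝ) → ℝ}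
    (hg : ContinuousWithinAt g s p) (hint : ∀ q ∈ s, ∃ a : ℤ, g q = a) (hp : p ∈ s) :
    ∀ᶠ q in 𝓝[s] p, g q = g p := by
  have h := hg.eventually (Metric.ball_mem_nhds (g p) one_pos)
  filter_upwards [h, self_mem_nhdsWithin] with q hq hqs
  obtain ⟨a, ha⟩ := hint q hqs
  obtain ⟨b, hb⟩ := hint p hp
  change dist (g q) (g p) < 1 at hq
  rw [Real.dist_eq, ha, hb] at hq
  have h1 : |a - b| < 1 := by exact_mod_cast hq
  have h2 := Int.abs_lt_one_iff.1 h1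
  rw [ha, hb]
  exact_mod_cast sub_eq_zero.1 h2

instance : IsManifold 𝓘(ℝ, Fin 4 → ℝ) ∞ KT := by
  refine isManifold_of_contDiffOn _ _ _ ?_
  rintro _ _ ⟨c, rfl⟩ ⟨d, rfl⟩
  set e : OpenPartialHomeomorph (Fin 4 → ℝ) (Fin 4 → ℝ) := (chart c).symm.trans (chart d) with he
  have hcont : ContinuousOn e e.source := e.continuousOn
  have hk : ∀ q ∈ e.source, ∃ k : Fin 4 → ℤ, e q = coordMul (fun i => (k i : ℝ)) q := by
    intro q hq
    rw [← proj_eq_iff]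
    rw [he, OpenPartialHomeomorph.trans_source] at hq
    exact proj_chart d hq.2
  have main : ContDiffOn ℝ ∞ e e.source := by
    intro p hp
    have hc : ∀ i, ContinuousWithinAt (fun q => e q i) e.source p := fun i =>
      (continuous_apply i).continuousAt.comp_continuousWithinAt (hcont p hp)
    have hid : ∀ i, ContinuousWithinAt (fun q : Fin 4 → ℝ => q i) e.source p := fun i =>
      (continuous_apply i).continuousWithinAt
    have e0 := eventually_eq_of_int ((hc 0).sub (hid 0)) (by
      intro q hq
      obtain ⟨k, hk⟩ := hk q hq
      exact ⟨k 0, by simp [hk, coordMul]⟩) hp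
    have e1 := eventually_eq_of_int ((hc 1).sub (hid 1)) (by
      intro q hq
      obtain ⟨k, hk⟩ := hk q hq
      exact ⟨k 1, by simp [hk, coordMul]⟩) hp
    have e2 := eventually_eq_of_int
      (((hc 2).sub (hid 2)).sub (((hc 0).sub (hid 0)).mul (hid 1))) (by
      intro q hq
      obtain ⟨k, hk⟩ := hk q hq
      exact ⟨k 2, by simp [hk, coordMul]; ring⟩) hp
    have e3 := eventually_eq_of_int ((hc 3).sub (hid 3)) (by
      intro q hq
      obtain ⟨k, hk⟩ := hk q hq
      exact ⟨k 3, by simp [hk, coordMul]⟩) hp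
    obtain ⟨k, hkp⟩ := hk p hp
    have hev : e =ᶠ[𝓝[e.source] p] coordMul (fun i => (k i : ℝ)) := by
      filter_upwards [e0, e1, e2, e3] with q h0 h1 h2 h3
      simp only [Pi.sub_apply, Pi.mul_apply] at h0 h1 h2 h3
      simp only [hkp, coordMul] at h0 h1 h2 h3
      simp at h0 h1 h2 h3
      funext i
      fin_cases i
      · simp [coordMul]; linarith
      · simp [coordMul]; linarith
      · simp [coordMul]
        rw [h0] at h2
        linarith
      · simp [coordMul]; linarith
    have hsm : ContDiff ℝ ∞ (coordMul (fun i => (k i : ℝ))) := by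
      rw [contDiff_pi]
      intro i
      fin_cases i <;> simp [coordMul] <;> fun_prop
    exact hsm.contDiffWithinAt.congr_of_eventuallyEq hev (hev.eq_of_nhdsWithin hp)
  simpa using main

/-! ### The frame and the almost complex structure on `M × Δ` -/

/-- The left invariant vector fields `e₁ = ∂_t`, `e₂ = ∂_x`, `e₃ = ∂_y + x ∂_z`, `e₄ = ∂_z` on `G`,
in the coordinates `(x, y, z, t)`. -/
def field (i : Fin 4) (p : Fin 4 → ℝ) : Fin 4 → ℝ :=
  (![![0, 0, 0, 1], ![1, 0, 0, 0], ![0, 1, p 0, 0], ![0, 0, 1, 0]] : Fin 4 → Fin 4 → ℝ) i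

/-- The vector fields induced by `e₁, …, e₄` on `M`. The tangent space of `M` at `m` is identified
with `ℝ⁴` by the chart at `m`, whose values are the coordinates `(x, y, z, t)` near `lift m`. -/
def frame (i : Fin 4) (m : KT) : TangentSpace 𝓘(ℝ, Fin 4 → ℝ) m := field i (lift m)

/-- The disc `Δ = {t : |t| < π}`. -/
def Δ : TopologicalSpace.Opens ℂ := ⟨Metric.ball 0 Real.pi, Metric.isOpen_ball⟩

/-- The standard complex structure on `Δ`. -/
def stdJ (t : Δ) : TangentSpace 𝓘(ℝ, ℂ) t →L[ℝ] TangentSpace 𝓘(ℝ, ℂ) t :=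
  (Complex.I • ContinuousLinearMap.id ℝ ℂ : ℂ →L[ℝ] ℂ)

/-- The global frame `e₁, …, e₆` of `M × Δ`; here `e₅` and `e₆` are the derivatives with respect to
the real and to the imaginary part of the coordinate of `Δ`. -/
def totalFrame (x : KT × Δ) :
    Fin 6 → TangentSpace (𝓘(ℝ, Fin 4 → ℝ).prod 𝓘(ℝ, ℂ)) x :=
  (![(field 0 (lift x.1), 0), (field 1 (lift x.1), 0), (field 2 (lift x.1), 0),
    (field 3 (lift x.1), 0), (0, 1), (0, Complex.I)] : Fin 6 → (Fin 4 → ℝ) × ℂ)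

theorem linearIndependent_totalFrame (x : KT × Δ) : LinearIndependent ℝ (totalFrame x) := by
  change LinearIndependent ℝ
    (![(field 0 (lift x.1), 0), (field 1 (lift x.1), 0), (field 2 (lift x.1), 0),
    (field 3 (lift x.1), 0), (0, 1), (0, Complex.I)] : Fin 6 → (Fin 4 → ℝ) × ℂ)
  rw [Fintype.linearIndependent_iff]
  intro g hg
  have h1 := congrArg Prod.fst hg
  have h2 := congrArg Prod.snd hg
  have h10 := congrFun h1 0
  have h11 := congrFun h1 1
  have h12 := congrFun h1 2
  have h13 := congrFun h1 3
  have h2r := congrArg Complex.re h2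
  have h2i := congrArg Complex.im h2
  simp [Fin.sum_univ_succ, field] at h10 h11 h12 h13 h2r h2i
  intro i
  fin_cases i
  · simpa using h13
  · simpa using h10
  · simpa using h11
  · have : g 2 = 0 := by simpa using h11
    simpa [this] using h12
  · simpa using h2r
  · simpa using h2i

/-- The global frame as a basis of the tangent space of `M × Δ` at `x`. -/
def totalBasis (x : KT × Δ) :
    Module.Basis (Fin 6) ℝ (TangentSpace (𝓘(ℝ, Fin 4 → ℝ).prod 𝓘(ℝ, ℂ)) x) :=
  basisOfLinearIndependentOfCardEqFinrank (linearIndependent_totalFrame x) (by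
    change Fintype.card (Fin 6) = Module.finrank ℝ ((Fin 4 → ℝ) × ℂ)
    simp)

theorem coe_totalBasis (x : KT × Δ) : ⇑(totalBasis x) = totalFrame x :=
  coe_basisOfLinearIndependentOfCardEqFinrank _ _

/-- The matrix of `J` at a point over `t ∈ Δ`. -/
def matrixJ (t : ℂ) : Matrix (Fin 6) (Fin 6) ℝ :=
  !![0, -1, 0, 0, 0, 0;
     1, 0, 0, 0, 0, 0;
     0, 0, -(t.im / (t.re + Real.pi)), -(‖t + Real.pi‖ ^ 2 / (t.re + Real.pi)), 0, 0;
     0, 0, 1 / (t.re + Real.pi), t.im / (t.re + Real.pi), 0, 0;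
     0, 0, 0, 0, 0, -1;
     0, 0, 0, 0, 1, 0]

instance (x : KT × Δ) :
    FiniteDimensional ℝ (TangentSpace (𝓘(ℝ, Fin 4 → ℝ).prod 𝓘(ℝ, ℂ)) x) :=
  inferInstanceAs (FiniteDimensional ℝ ((Fin 4 → ℝ) × ℂ))

instance (x : KT × Δ) : T2Space (TangentSpace (𝓘(ℝ, Fin 4 → ℝ).prod 𝓘(ℝ, ℂ)) x) :=
  inferInstanceAs (T2Space ((Fin 4 → ℝ) × ℂ))

/-- The almost complex structure `J` on `M × Δ`. -/
def totalJ (x : KT × Δ) :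
    TangentSpace (𝓘(ℝ, Fin 4 → ℝ).prod 𝓘(ℝ, ℂ)) x →L[ℝ]
      TangentSpace (𝓘(ℝ, Fin 4 → ℝ).prod 𝓘(ℝ, ℂ)) x :=
  LinearMap.toContinuousLinearMap (Matrix.toLin (totalBasis x) (totalBasis x) (matrixJ x.2))

/-- The inclusion of the fibre `M_t = M × {t}`. -/
def fibreIncl (t : Δ) (m : KT) : KT × Δ := (m, t)

/-- The almost complex structure `J_t` on the fibre `M_t`, as a structure on `M`: the restriction
of `J` to `T(M × {t})`, followed by the differential of the projection to `M`. -/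
def fibreJ (t : Δ) (m : KT) :
    TangentSpace 𝓘(ℝ, Fin 4 → ℝ) m →L[ℝ] TangentSpace 𝓘(ℝ, Fin 4 → ℝ) m :=
  (mfderiv (𝓘(ℝ, Fin 4 → ℝ).prod 𝓘(ℝ, ℂ)) 𝓘(ℝ, Fin 4 → ℝ) Prod.fst (fibreIncl t m)).comp
    ((totalJ (fibreIncl t m)).comp
      (mfderiv 𝓘(ℝ, Fin 4 → ℝ) (𝓘(ℝ, Fin 4 → ℝ).prod 𝓘(ℝ, ℂ)) (fibreIncl t) m))

/-- A real number of absolute value less than `π` as a point of `Δ`. -/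
def realPoint (s : Ioo (-Real.pi) Real.pi) : Δ :=
  ⟨((s : ℝ) : ℂ), by
    change ((s : ℝ) : ℂ) ∈ Metric.ball (0 : ℂ) Real.pi
    rw [mem_ball_zero_iff, Complex.norm_real, Real.norm_eq_abs, abs_lt]
    exact s.2⟩

/-- The set `π ℚ` of rational multiples of `π`. -/
def piRat : Set ℝ := {s | ∃ q : ℚ, s = Real.pi * q}

/-- The `m`-th plurigenus of the fibre `M_t`. -/
def fibrePlurigenus (m : ℕ) (t : Δ) : ℕ := AlmostComplex.plurigenus (fibreJ t) 2 m

/-- The Kodaira dimension of the fibre `M_t`. -/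
def fibreKod (t : Δ) : EReal := AlmostComplex.kodairaDim (fibreJ t) 2

end KodairaThurston

end

namespace KodairaThurston

open AlmostComplex

/-! ### Topology and charts of the Kodaira–Thurston manifold -/

/-! Everything on `KT` is left invariant, so it can be computed on the covering by ℝ⁴. There
`coordJ` is the fibre structure, and `dproj_field` and `dproj_coordJ` express the invariance of the
frame and of the structure. Smoothness and J² = -1 then reduce to rational formulas whose
denominator Re t + π is positive on the disc.

The (1,0)-forms on the fibre over t are spanned by φ₁ = e¹ + i e² and φ₂ = e³ + κ e⁴. Hence Φ = φ₁ ∧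
φ₂ is a global frame of the canonical bundle. The only nonzero structure equation is de⁴ = -e² ∧ e³,
and it gives ∂̄Φ = c φ̄₁ ⊗ Φ with the real constant c = |t + π|² / (4 (Re t + π))
(`dbarForm_eq_smul`). So f Φ^k is pseudoholomorphic iff ∂̄f + k c f φ̄₁ = 0
(`exists_isSolution_of_mem`, `mem_of_isSolution`).

Compactness makes every solution bounded, and Liouville's theorem is applied twice to its lift.
Along the planes spanned by e₃ and Je₃ the lift is holomorphic, hence constant, so it depends on x
and t only. After multiplication by the unimodular factor exp(-2ikcx) it is holomorphic in the (t,
x)-plane, hence constant there. So f = f(0) exp(2ikcx) (`IsSolution.apply_eq`). This function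
descends to `KT` iff it is invariant under x ↦ x + 1, that is iff kc ∈ πℤ, which is the condition
`IsResonant`.

The k-th plurigenus is therefore the indicator function of a closed subset of the disc, which gives
upper semicontinuity. For real t = s one has c = (s + π)/4, so some k ≥ 1 is resonant iff s ∈ πℚ,
and then all multiples of that k are resonant too. The Kodaira dimension is thus 0 on πℚ and -∞ off
it; both sets are dense, so semicontinuity fails. -/

theorem isOpenQuotientMap_proj : IsOpenQuotientMap proj :=
  ⟨proj_surjective, continuous_proj, isOpenMap_proj⟩

theorem proj_coordMul (k : Fin 4 → ℤ) (p : Fin 4 → ℝ) :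
    proj (coordMul (fun i => (k i : ℝ)) p) = proj p :=
  (proj_eq_iff _ _).2 ⟨k, rfl⟩

theorem proj_eq_iff_mem_range_intCast (p q : Fin 4 → ℝ) :
    proj p = proj q ↔ p 0 - q 0 ∈ range ((↑) : ℤ → ℝ) ∧ p 1 - q 1 ∈ range ((↑) : ℤ → ℝ) ∧
      p 2 - q 2 - (p 0 - q 0) * q 1 ∈ range ((↑) : ℤ → ℝ) ∧
      p 3 - q 3 ∈ range ((↑) : ℤ → ℝ) := by
  rw [proj_eq_iff]
  constructor
  · rintro ⟨k, rfl⟩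
    exact ⟨⟨k 0, by simp [coordMul]⟩, ⟨k 1, by simp [coordMul]⟩,
      ⟨k 2, by simp [coordMul]; ring⟩, ⟨k 3, by simp [coordMul]⟩⟩
  · rintro ⟨⟨k0, h0⟩, ⟨k1, h1⟩, ⟨k2, h2⟩, ⟨k3, h3⟩⟩
    refine ⟨![k0, k1, k2, k3], ?_⟩
    rw [← h0] at h2
    funext i
    fin_cases i <;> simp [coordMul] <;> linarith

/-- For an open quotient map it suffices that the equivalence relation is closed, and here it says
that four continuous functions of the pair take values in the closed set ℤ. -/
instance : T2Space KT := by
  rw [t2Space_iff_of_isOpenQuotientMap isOpenQuotientMap_proj]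
  simp only [proj_eq_iff_mem_range_intCast, ofPred_and]
  have h := Real.isClosed_range_intCast
  refine (h.preimage (by fun_prop)).inter ((h.preimage (by fun_prop)).inter
    ((h.preimage (by fun_prop)).inter (h.preimage (by fun_prop))))

theorem proj_image_Icc : proj '' Icc 0 1 = univ := by
  refine eq_univ_of_forall fun m => ?_
  obtain ⟨p, rfl⟩ := proj_surjective m
  -- Left translation by k sends z to k₂ + z + k₀ y, so z has to be corrected by ⌊x⌋ times the
  -- reduced y before its fractional part is taken.
  refine ⟨![Int.fract (p 0), Int.fract (p 1), Int.fract (p 2 - ⌊p 0⌋ * Int.fract (p 1)),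
    Int.fract (p 3)], ⟨?_, ?_⟩, ?_⟩
  · intro i
    fin_cases i <;> simp
  · intro i
    fin_cases i <;> simp [(Int.fract_lt_one _).le]
  · symm
    rw [proj_eq_iff_mem_range_intCast]
    refine ⟨⟨⌊p 0⌋, ?_⟩, ⟨⌊p 1⌋, ?_⟩, ⟨⌊p 2 - ⌊p 0⌋ * Int.fract (p 1)⌋, ?_⟩, ⟨⌊p 3⌋, ?_⟩⟩
    · simp
    · simp
    · simp only [Matrix.cons_val, Int.self_sub_fract]
      linarith [Int.self_sub_fract (p 2 - ⌊p 0⌋ * Int.fract (p 1))]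
    · simp

instance : CompactSpace KT :=
  ⟨proj_image_Icc ▸ isCompact_Icc.image continuous_proj⟩

theorem chart_proj {c p : Fin 4 → ℝ} (hp : p ∈ Metric.ball c (1 / 2)) : chart c (proj p) = p :=
  (chart c).right_inv hp

theorem chartAt_eq (m : KT) : chartAt (Fin 4 → ℝ) m = chart (lift m) := rfl

theorem extChartAt_eq (m : KT) : ⇑(extChartAt 𝓘(ℝ, Fin 4 → ℝ) m) = chart (lift m) := by
  simp [chartAt_eq]

theorem extChartAt_symm_eq (m : KT) : ⇑(extChartAt 𝓘(ℝ, Fin 4 → ℝ) m).symm = proj := by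
  simp [chartAt_eq]
  rfl

theorem extChartAt_target_eq (m : KT) :
    (extChartAt 𝓘(ℝ, Fin 4 → ℝ) m).target = Metric.ball (lift m) (1 / 2) := by
  simp [chartAt_eq, chart_target]

theorem extChartAt_self (m : KT) : extChartAt 𝓘(ℝ, Fin 4 → ℝ) m m = lift m := by
  have h := chart_proj (Metric.mem_ball_self (x := lift m) (ε := 1 / 2) (by norm_num))
  rwa [proj_lift, ← extChartAt_eq] at h

theorem contMDiff_proj : ContMDiff 𝓘(ℝ, Fin 4 → ℝ) 𝓘(ℝ, Fin 4 → ℝ) ∞ proj := by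
  intro p
  have h : chart p ∈ IsManifold.maximalAtlas 𝓘(ℝ, Fin 4 → ℝ) ∞ KT :=
    IsManifold.subset_maximalAtlas ⟨p, rfl⟩
  exact (contMDiffOn_symm_of_mem_maximalAtlas h).contMDiffAt
    ((chart p).open_target.mem_nhds (Metric.mem_ball_self (by norm_num)))

theorem mdifferentiable_proj : MDifferentiable 𝓘(ℝ, Fin 4 → ℝ) 𝓘(ℝ, Fin 4 → ℝ) proj :=
  contMDiff_proj.mdifferentiable (by simp)

theorem mem_chartAt_source {m : KT} {y : Fin 4 → ℝ} (hy : y ∈ Metric.ball (lift m) (1 / 2)) :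
    proj y ∈ (chartAt (Fin 4 → ℝ) m).source :=
  ⟨y, hy, rfl⟩

/-! ### The differential of the covering and the invariant frame -/

theorem mfderiv_extChartAt_mfderiv_proj {m : KT} {y : Fin 4 → ℝ}
    (hy : y ∈ Metric.ball (lift m) (1 / 2)) (v : Fin 4 → ℝ) :
    mfderiv 𝓘(ℝ, Fin 4 → ℝ) 𝓘(ℝ, Fin 4 → ℝ) (extChartAt 𝓘(ℝ, Fin 4 → ℝ) m) (proj y)
      (mfderiv 𝓘(ℝ, Fin 4 → ℝ) 𝓘(ℝ, Fin 4 → ℝ) proj y v) = v := by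
  have h1 := mfderiv_comp y
    (mdifferentiableAt_extChartAt (I := 𝓘(ℝ, Fin 4 → ℝ)) (mem_chartAt_source hy))
    (mdifferentiable_proj y)
  have h2 : (extChartAt 𝓘(ℝ, Fin 4 → ℝ) m) ∘ proj =ᶠ[𝓝 y] id := by
    filter_upwards [Metric.isOpen_ball.mem_nhds hy] with q hq
    rw [Function.comp, extChartAt_eq, chart_proj hq, id]
  rw [h2.mfderiv_eq, mfderiv_id] at h1
  exact (DFunLike.congr_fun h1 v).symm

/-- The tangent space at `m` is read in the chart at `m`, and near `lift m` that chart inverts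
`proj`. At other points above `m` the differential is a shear, as `exists_dproj_eq` makes explicit.
-/
theorem mfderiv_proj_lift (m : KT) (v : Fin 4 → ℝ) :
    mfderiv 𝓘(ℝ, Fin 4 → ℝ) 𝓘(ℝ, Fin 4 → ℝ) proj (lift m) v = v := by
  have h := mfderiv_extChartAt_mfderiv_proj (m := m) (Metric.mem_ball_self (by norm_num)) v
  rw [proj_lift, mfderiv_extChartAt_self] at h
  exact h

theorem hasFDerivAt_coordMul (k p v : Fin 4 → ℝ) :
    ∃ L : (Fin 4 → ℝ) →L[ℝ] (Fin 4 → ℝ), HasFDerivAt (coordMul k) L p ∧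
      L v = ![v 0, v 1, v 2 + k 0 * v 1, v 3] := by
  have h : ∀ q, coordMul k q = k + (ContinuousLinearMap.pi ![ContinuousLinearMap.proj 0,
    ContinuousLinearMap.proj 1, ContinuousLinearMap.proj 2 + k 0 • ContinuousLinearMap.proj 1,
    ContinuousLinearMap.proj 3] : (Fin 4 → ℝ) →L[ℝ] (Fin 4 → ℝ)) q := by
    intro q
    funext i
    fin_cases i <;> simp [coordMul]
    ring
  refine ⟨_, by rw [funext h]; exact (ContinuousLinearMap.hasFDerivAt _).const_add _, ?_⟩
  funext i
  fin_cases i <;> simp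

theorem field_coordMul (i : Fin 4) (k p : Fin 4 → ℝ) :
    field i (coordMul k p) = ![field i p 0, field i p 1, field i p 2 + k 0 * field i p 1,
      field i p 3] := by
  funext j
  fin_cases i <;> fin_cases j <;> simp [field, coordMul]
  ring

/-- The differential of the covering `proj`, as an endomorphism of the model space. -/
noncomputable def dproj (p : Fin 4 → ℝ) : (Fin 4 → ℝ) →L[ℝ] (Fin 4 → ℝ) :=
  mfderiv 𝓘(ℝ, Fin 4 → ℝ) 𝓘(ℝ, Fin 4 → ℝ) proj p

theorem hasMFDerivAt_proj (p : Fin 4 → ℝ) :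
    HasMFDerivAt 𝓘(ℝ, Fin 4 → ℝ) 𝓘(ℝ, Fin 4 → ℝ) proj p (dproj p) :=
  (mdifferentiable_proj p).hasMFDerivAt

theorem dproj_lift (m : KT) (v : Fin 4 → ℝ) : dproj (lift m) v = v :=
  mfderiv_proj_lift m v

theorem hasMFDerivAt_of_eq {f g : (Fin 4 → ℝ) → KT} (h : f = g) {p : Fin 4 → ℝ}
    {L : (Fin 4 → ℝ) →L[ℝ] (Fin 4 → ℝ)}
    (hf : HasMFDerivAt 𝓘(ℝ, Fin 4 → ℝ) 𝓘(ℝ, Fin 4 → ℝ) f p L) :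
    HasMFDerivAt 𝓘(ℝ, Fin 4 → ℝ) 𝓘(ℝ, Fin 4 → ℝ) g p L := by
  subst h
  exact hf

/-- Chain rule for the identity `proj ∘ coordMul k = proj`; the displayed vector is the image of `v`
under the differential of the left translation. -/
theorem dproj_coordMul (k : Fin 4 → ℤ) (p v : Fin 4 → ℝ) :
    dproj (coordMul (fun i => (k i : ℝ)) p) ![v 0, v 1, v 2 + k 0 * v 1, v 3] = dproj p v := by
  obtain ⟨L, hL, hLv⟩ := hasFDerivAt_coordMul (fun i => (k i : ℝ)) p v
  have h1 : HasMFDerivAt 𝓘(ℝ, Fin 4 → ℝ) 𝓘(ℝ, Fin 4 → ℝ) proj p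
      ((dproj (coordMul (fun i => (k i : ℝ)) p)).comp L) :=
    hasMFDerivAt_of_eq (funext fun q => proj_coordMul k q)
      ((hasMFDerivAt_proj _).comp p hL.hasMFDerivAt)
  have h2 : (dproj (coordMul (fun i => (k i : ℝ)) p)).comp L = dproj p := h1.mfderiv.symm
  rw [← hLv, ← h2]
  rfl

/-- The points `p` and `lift (proj p)` differ by a lattice translation, under which the left
invariant fields are preserved. -/
theorem dproj_field (p : Fin 4 → ℝ) (i : Fin 4) :
    dproj p (field i p) = field i (lift (proj p)) := by
  obtain ⟨k, hk⟩ := (proj_eq_iff p (lift (proj p))).1 (proj_lift _).symm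
  have h1 := dproj_coordMul k (lift (proj p)) (field i (lift (proj p)))
  rw [dproj_lift] at h1
  rw [← h1, ← field_coordMul i (fun i => (k i : ℝ)), ← hk]

theorem mfderiv_proj_field (p : Fin 4 → ℝ) (i : Fin 4) :
    mfderiv 𝓘(ℝ, Fin 4 → ℝ) 𝓘(ℝ, Fin 4 → ℝ) proj p (field i p) = frame i (proj p) :=
  dproj_field p i

/-! ### The almost complex structures -/

/-- The endomorphism `J` over `t`, on tangent vectors of `G` at the point with coordinates `p`. -/
noncomputable def coordJ (t : ℂ) (p v : Fin 4 → ℝ) : Fin 4 → ℝ :=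
  let b := -(t.im / (t.re + Real.pi)) * v 1 -
    (‖t + Real.pi‖ ^ 2 / (t.re + Real.pi)) * (v 2 - p 0 * v 1)
  ![v 3, b, 1 / (t.re + Real.pi) * v 1 + t.im / (t.re + Real.pi) * (v 2 - p 0 * v 1) + p 0 * b,
    -v 0]

theorem Δ_re_pos (t : Δ) : 0 < (t : ℂ).re + Real.pi := by
  have h : ‖(t : ℂ)‖ < Real.pi := mem_ball_zero_iff.1 t.2
  linarith [(abs_le.1 (Complex.abs_re_le_norm (t : ℂ))).1]

theorem norm_add_pi_sq (t : ℂ) :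
    ‖t + Real.pi‖ ^ 2 = (t.re + Real.pi) ^ 2 + t.im ^ 2 := by
  rw [← Complex.normSq_eq_norm_sq, Complex.normSq_apply]
  simp
  ring

/-- The frame of `M × Δ`, in the coordinates `p` of `G`. -/
noncomputable def coordFrame (p : Fin 4 → ℝ) : Fin 6 → (Fin 4 → ℝ) × ℂ :=
  ![(field 0 p, 0), (field 1 p, 0), (field 2 p, 0), (field 3 p, 0), (0, 1), (0, Complex.I)]

/-- Expands a vector in the frame. The statement is about an endomorphism of the model space, so
that the computation does not meet tangent space types. -/
theorem apply_of_apply_coordFrame {p : Fin 4 → ℝ} {t : ℂ}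
    {T : ((Fin 4 → ℝ) × ℂ) →L[ℝ] ((Fin 4 → ℝ) × ℂ)}
    (hT : ∀ i, T (coordFrame p i) = ∑ j, matrixJ t j i • coordFrame p j)
    (v : Fin 4 → ℝ) (s : ℂ) : T (v, s) = (coordJ t p v, Complex.I * s) := by
  have h1 : (v, s) =
      ∑ i, (![v 3, v 0, v 1, v 2 - p 0 * v 1, s.re, s.im] : Fin 6 → ℝ) i • coordFrame p i := by
    refine Prod.ext ?_ ?_
    · funext j
      fin_cases j <;> simp [coordFrame, field, Fin.sum_univ_succ]
      ring
    · apply Complex.ext <;> simp [coordFrame, Fin.sum_univ_succ]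
  rw [h1, map_sum]
  simp only [map_smul, hT]
  refine Prod.ext (funext fun j => ?_) (Complex.ext ?_ ?_)
  · fin_cases j <;> simp [coordFrame, field, Fin.sum_univ_succ, matrixJ, coordJ]
    all_goals ring
  · simp [coordFrame, Fin.sum_univ_succ, matrixJ]
  · simp [coordFrame, Fin.sum_univ_succ, matrixJ]

theorem totalJ_apply (x : KT × Δ) (v : Fin 4 → ℝ) (s : ℂ) :
    totalJ x ((v, s) : (Fin 4 → ℝ) × ℂ) =
      ((coordJ x.2 (lift x.1) v, Complex.I * s) : (Fin 4 → ℝ) × ℂ) := by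
  refine apply_of_apply_coordFrame (T := totalJ x) (fun i => ?_) v s
  have h := Matrix.toLin_self (totalBasis x) (totalBasis x) (matrixJ x.2) i
  rw [coe_totalBasis] at h
  exact h

/-- The middle 2 × 2 block has trace 0 and, because |t + π|² = (Re t + π)² + (Im t)², determinant 1.
-/
theorem coordJ_coordJ (t : Δ) (p v : Fin 4 → ℝ) : coordJ t p (coordJ t p v) = -v := by
  have h := (Δ_re_pos t).ne'
  funext j
  fin_cases j <;> simp [coordJ, norm_add_pi_sq] <;> field_simp <;> ring

theorem exists_dproj_eq (y : Fin 4 → ℝ) : ∃ k : Fin 4 → ℤ,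
    y = coordMul (fun i => (k i : ℝ)) (lift (proj y)) ∧
      ∀ v, dproj y v = ![v 0, v 1, v 2 - k 0 * v 1, v 3] := by
  obtain ⟨k, hk⟩ := (proj_eq_iff y (lift (proj y))).1 (proj_lift _).symm
  refine ⟨k, hk, fun v => ?_⟩
  have h := dproj_coordMul k (lift (proj y)) ![v 0, v 1, v 2 - k 0 * v 1, v 3]
  rw [dproj_lift, ← hk] at h
  rw [← h]
  congr 1
  funext j
  fin_cases j <;> simp

theorem dproj_surjective (y : Fin 4 → ℝ) : Function.Surjective (dproj y) := by
  obtain ⟨k, -, h⟩ := exists_dproj_eq y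
  intro v
  refine ⟨![v 0, v 1, v 2 + k 0 * v 1, v 3], ?_⟩
  rw [h]
  funext j
  fin_cases j <;> simp

/-- Left invariance of the structure: the shear in `dproj` compensates the change of x by the
integer `k 0`. -/
theorem dproj_coordJ (t : ℂ) (y v : Fin 4 → ℝ) :
    dproj y (coordJ t y v) = coordJ t (lift (proj y)) (dproj y v) := by
  obtain ⟨k, hk, h⟩ := exists_dproj_eq y
  have h0 : y 0 = k 0 + lift (proj y) 0 := by conv_lhs => rw [hk]; simp [coordMul]
  rw [h, h]
  funext j
  fin_cases j <;> simp [coordJ, h0, -mul_eq_mul_left_iff] <;> ring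

theorem extChartAt_Δ (t : Δ) : ⇑(extChartAt 𝓘(ℝ, ℂ) t) = Subtype.val := by
  ext s
  simp [TopologicalSpace.Opens.chartAt_eq, chartAt_self_eq]

theorem hasMFDerivAt_val (t : Δ) :
    HasMFDerivAt 𝓘(ℝ, ℂ) 𝓘(ℝ, ℂ) (Subtype.val : Δ → ℂ) t (ContinuousLinearMap.id ℝ ℂ) := by
  have h : MDifferentiableAt 𝓘(ℝ, ℂ) 𝓘(ℝ, ℂ) (extChartAt 𝓘(ℝ, ℂ) t) t :=
    mdifferentiableAt_extChartAt (mem_chart_source _ t)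
  have h2 := h.hasMFDerivAt
  rw [mfderiv_extChartAt_self, extChartAt_Δ] at h2
  exact h2

/-- Near `(y, t)` the chart composed with `proj × id` is the inclusion into ℝ⁴ × ℂ, whose
differential is the identity. -/
theorem mfderiv_extChartAt_prod {x : KT × Δ} {y : Fin 4 → ℝ}
    (hy : y ∈ Metric.ball (lift x.1) (1 / 2)) (t : Δ) (v : Fin 4 → ℝ) (s : ℂ) :
    mfderiv (𝓘(ℝ, Fin 4 → ℝ).prod 𝓘(ℝ, ℂ)) 𝓘(ℝ, (Fin 4 → ℝ) × ℂ)
      (extChartAt (𝓘(ℝ, Fin 4 → ℝ).prod 𝓘(ℝ, ℂ)) x) (proj y, t)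
      ((dproj y v, s) : (Fin 4 → ℝ) × ℂ) = ((v, s) : (Fin 4 → ℝ) × ℂ) := by
  have hsrc : ((proj y, t) : KT × Δ) ∈ (chartAt (ModelProd (Fin 4 → ℝ) ℂ) x).source := by
    rw [prodChartedSpace_chartAt]
    exact ⟨mem_chartAt_source hy, by simp [TopologicalSpace.Opens.chartAt_eq, chartAt_self_eq]⟩
  obtain ⟨A, hA⟩ : ∃ A : ((Fin 4 → ℝ) × ℂ) →L[ℝ] ((Fin 4 → ℝ) × ℂ),
      A = mfderiv (𝓘(ℝ, Fin 4 → ℝ).prod 𝓘(ℝ, ℂ)) 𝓘(ℝ, (Fin 4 → ℝ) × ℂ)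
      (extChartAt (𝓘(ℝ, Fin 4 → ℝ).prod 𝓘(ℝ, ℂ)) x) (proj y, t) := ⟨_, rfl⟩
  have h1 : HasMFDerivAt (𝓘(ℝ, Fin 4 → ℝ).prod 𝓘(ℝ, ℂ)) 𝓘(ℝ, (Fin 4 → ℝ) × ℂ)
      (extChartAt (𝓘(ℝ, Fin 4 → ℝ).prod 𝓘(ℝ, ℂ)) x) (proj y, t) A := by
    rw [hA]
    exact (mdifferentiableAt_extChartAt hsrc).hasMFDerivAt
  have h2 : HasMFDerivAt (𝓘(ℝ, Fin 4 → ℝ).prod 𝓘(ℝ, ℂ)) (𝓘(ℝ, Fin 4 → ℝ).prod 𝓘(ℝ, ℂ))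
      (Prod.map proj id : (Fin 4 → ℝ) × Δ → KT × Δ) (y, t)
      ((dproj y).prodMap (ContinuousLinearMap.id ℝ ℂ)) :=
    ((hasMFDerivAt_proj y).comp (y, t) (hasMFDerivAt_fst (y, t))).prodMk
      (hasMFDerivAt_snd (y, t))
  have h3 : HasMFDerivAt (𝓘(ℝ, Fin 4 → ℝ).prod 𝓘(ℝ, ℂ)) 𝓘(ℝ, (Fin 4 → ℝ) × ℂ)
      (extChartAt (𝓘(ℝ, Fin 4 → ℝ).prod 𝓘(ℝ, ℂ)) x ∘ Prod.map proj id) (y, t)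
      (A.comp ((dproj y).prodMap (ContinuousLinearMap.id ℝ ℂ))) :=
    HasMFDerivAt.comp (y, t) h1 h2
  have h4 : HasMFDerivAt (𝓘(ℝ, Fin 4 → ℝ).prod 𝓘(ℝ, ℂ)) 𝓘(ℝ, (Fin 4 → ℝ) × ℂ)
      (Prod.map id Subtype.val : (Fin 4 → ℝ) × Δ → (Fin 4 → ℝ) × ℂ) (y, t)
      (ContinuousLinearMap.id ℝ ((Fin 4 → ℝ) × ℂ)) := by
    have hf := hasMFDerivAt_fst (I := 𝓘(ℝ, Fin 4 → ℝ)) (I' := 𝓘(ℝ, ℂ)) (y, t)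
    have hg := (hasMFDerivAt_val t).comp (y, t)
      (hasMFDerivAt_snd (I := 𝓘(ℝ, Fin 4 → ℝ)) (I' := 𝓘(ℝ, ℂ)) (y, t))
    exact ⟨hf.1.prodMk hg.1, hf.2.prodMk hg.2⟩
  have h5 : extChartAt (𝓘(ℝ, Fin 4 → ℝ).prod 𝓘(ℝ, ℂ)) x ∘ Prod.map proj id =ᶠ[𝓝 (y, t)]
      (Prod.map id Subtype.val : (Fin 4 → ℝ) × Δ → (Fin 4 → ℝ) × ℂ) := by
    filter_upwards [(Metric.isOpen_ball.preimage continuous_fst).mem_nhds hy] with q hq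
    rw [extChartAt_prod, Function.comp, PartialEquiv.prod_coe, extChartAt_Δ, extChartAt_eq]
    exact Prod.ext (chart_proj hq) rfl
  have h6 : A.comp ((dproj y).prodMap (ContinuousLinearMap.id ℝ ℂ)) =
      ContinuousLinearMap.id ℝ ((Fin 4 → ℝ) × ℂ) :=
    hasMFDerivAt_unique (h3.congr_of_eventuallyEq h5.symm) h4
  rw [← hA]
  exact DFunLike.congr_fun h6 (v, s)

theorem trivializationAt_snd {x₀ : KT × Δ} {y : Fin 4 → ℝ}
    (hy : y ∈ Metric.ball (lift x₀.1) (1 / 2)) (t : Δ) (v : Fin 4 → ℝ) (s : ℂ) :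
    (trivializationAt ((Fin 4 → ℝ) × ℂ) (TangentSpace (𝓘(ℝ, Fin 4 → ℝ).prod 𝓘(ℝ, ℂ))) x₀
      ⟨(proj y, t), ((dproj y v, s) : (Fin 4 → ℝ) × ℂ)⟩).2 = (v, s) := by
  have hsrc : ((proj y, t) : KT × Δ) ∈ (chartAt (ModelProd (Fin 4 → ℝ) ℂ) x₀).source := by
    rw [prodChartedSpace_chartAt]
    exact ⟨mem_chartAt_source hy, by simp [TopologicalSpace.Opens.chartAt_eq, chartAt_self_eq]⟩
  have h1 := TangentBundle.continuousLinearMapAt_trivializationAt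
    (I := 𝓘(ℝ, Fin 4 → ℝ).prod 𝓘(ℝ, ℂ)) hsrc
  have h2 := DFunLike.congr_fun h1 ((dproj y v, s) : (Fin 4 → ℝ) × ℂ)
  have h3 := h2.trans (mfderiv_extChartAt_prod hy t v s)
  exact (Bundle.Trivialization.continuousLinearMapAt_apply_of_mem (R := ℝ) _ hsrc _).symm.trans h3

theorem contDiffAt_coordJ {q : ((Fin 4 → ℝ) × ℂ) × ((Fin 4 → ℝ) × ℂ)}
    (hq : q.1.2.re + Real.pi ≠ 0) :
    ContDiffAt ℝ ∞ (fun q : ((Fin 4 → ℝ) × ℂ) × ((Fin 4 → ℝ) × ℂ) =>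
      (coordJ q.1.2 q.1.1 q.2.1, Complex.I * q.2.2)) q := by
  have hre : ContDiff ℝ ∞ Complex.re := Complex.reCLM.contDiff
  have him : ContDiff ℝ ∞ Complex.im := Complex.imCLM.contDiff
  refine ContDiffAt.prodMk ?_ (by fun_prop)
  rw [contDiffAt_pi]
  intro j
  simp only [coordJ, norm_add_pi_sq]
  fin_cases j <;> simp <;> fun_prop (disch := assumption)

/-- In a trivialization of the tangent bundle the fibre component of the map is the explicit formula
of `contDiffAt_coordJ`, because the trivialization undoes `dproj` at every point of the chart
domain. -/
theorem contMDiff_totalJ : ContMDiff (𝓘(ℝ, Fin 4 → ℝ).prod 𝓘(ℝ, ℂ)).tangent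
    (𝓘(ℝ, Fin 4 → ℝ).prod 𝓘(ℝ, ℂ)).tangent ∞
    (fun v : TangentBundle (𝓘(ℝ, Fin 4 → ℝ).prod 𝓘(ℝ, ℂ)) (KT × Δ) =>
      (⟨v.1, totalJ v.1 v.2⟩ : TangentBundle (𝓘(ℝ, Fin 4 → ℝ).prod 𝓘(ℝ, ℂ)) (KT × Δ))) := by
  intro v₀
  have hbase : ContMDiffAt (𝓘(ℝ, Fin 4 → ℝ).prod 𝓘(ℝ, ℂ)).tangent
      (𝓘(ℝ, Fin 4 → ℝ).prod 𝓘(ℝ, ℂ)) ∞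
      (fun v : TangentBundle (𝓘(ℝ, Fin 4 → ℝ).prod 𝓘(ℝ, ℂ)) (KT × Δ) => v.1) v₀ :=
    Bundle.contMDiff_proj _ v₀
  refine (Bundle.contMDiffAt_totalSpace).2 ⟨hbase, ?_⟩
  have hU := ((Bundle.contMDiffAt_totalSpace).1
    (contMDiffAt_id (I := (𝓘(ℝ, Fin 4 → ℝ).prod 𝓘(ℝ, ℂ)).tangent) (x := v₀) (n := ∞))).2
  have hY : ContMDiffAt (𝓘(ℝ, Fin 4 → ℝ).prod 𝓘(ℝ, ℂ)).tangent 𝓘(ℝ, (Fin 4 → ℝ) × ℂ) ∞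
      (fun v : TangentBundle (𝓘(ℝ, Fin 4 → ℝ).prod 𝓘(ℝ, ℂ)) (KT × Δ) =>
        extChartAt (𝓘(ℝ, Fin 4 → ℝ).prod 𝓘(ℝ, ℂ)) v₀.1 v.1) v₀ :=
    contMDiffAt_extChartAt.comp v₀ hbase
  have hre : (extChartAt (𝓘(ℝ, Fin 4 → ℝ).prod 𝓘(ℝ, ℂ)) v₀.1 v₀.1).2.re + Real.pi ≠ 0 := by
    rw [extChartAt_prod, PartialEquiv.prod_coe, extChartAt_Δ]
    exact (Δ_re_pos _).ne'
  have hYU := hY.prodMk_space hU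
  have hmain := ContDiffAt.comp_contMDiffAt (contDiffAt_coordJ (by exact hre)) hYU
  refine hmain.congr_of_eventuallyEq ?_
  have hsrc : ∀ᶠ v in 𝓝 v₀, v.1.1 ∈ (chartAt (Fin 4 → ℝ) v₀.1.1).source :=
    (continuous_fst.continuousAt.comp hbase.continuousAt).eventually
      ((chartAt (Fin 4 → ℝ) v₀.1.1).open_source.mem_nhds (mem_chart_source _ _))
  filter_upwards [hsrc] with v hv
  obtain ⟨⟨m, t⟩, ⟨w, s⟩⟩ := v
  obtain ⟨y, hy, rfl⟩ := hv
  -- Writing the tangent vector as the image of `u` at the point `y` of the chart lets the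
  -- trivialization be evaluated both on it and on its image under the structure.
  obtain ⟨u, rfl⟩ := dproj_surjective y w
  have h1 : extChartAt (𝓘(ℝ, Fin 4 → ℝ).prod 𝓘(ℝ, ℂ)) v₀.1 (proj y, t) = (y, (t : ℂ)) := by
    rw [extChartAt_prod, PartialEquiv.prod_coe, extChartAt_Δ, extChartAt_eq]
    exact Prod.ext (chart_proj hy) rfl
  have h2 := trivializationAt_snd hy t u s
  have h3 := trivializationAt_snd hy t (coordJ t y u) (Complex.I * s)
  rw [dproj_coordJ] at h3
  have h4 : (⟨(proj y, t), totalJ (proj y, t) ((dproj y u, s) : (Fin 4 → ℝ) × ℂ)⟩ :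
      TangentBundle (𝓘(ℝ, Fin 4 → ℝ).prod 𝓘(ℝ, ℂ)) (KT × Δ)) =
      ⟨(proj y, t), ((coordJ t (lift (proj y)) (dproj y u), Complex.I * s) :
        (Fin 4 → ℝ) × ℂ)⟩ := congrArg _ (totalJ_apply (proj y, t) (dproj y u) s)
  refine (congrArg (fun q => (trivializationAt ((Fin 4 → ℝ) × ℂ)
    (TangentSpace (𝓘(ℝ, Fin 4 → ℝ).prod 𝓘(ℝ, ℂ))) v₀.1 q).2) h4).trans (h3.trans ?_)
  simp only [Function.comp]
  erw [h1, h2]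

theorem isAlmostComplexStructure_totalJ :
    AlmostComplex.IsAlmostComplexStructure (𝓘(ℝ, Fin 4 → ℝ).prod 𝓘(ℝ, ℂ)) totalJ where
  sq_eq_neg := by
    rintro x ⟨v, s⟩
    refine (congrArg (totalJ x) (totalJ_apply x v s)).trans ((totalJ_apply x _ _).trans ?_)
    rw [coordJ_coordJ, ← mul_assoc, Complex.I_mul_I, neg_one_mul]
    rfl
  smooth := contMDiff_totalJ

theorem isPseudoholomorphic_snd :
    AlmostComplex.IsPseudoholomorphic (𝓘(ℝ, Fin 4 → ℝ).prod 𝓘(ℝ, ℂ)) 𝓘(ℝ, ℂ)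
      totalJ stdJ (Prod.snd : KT × Δ → Δ) where
  smooth := contMDiff_snd
  comm := by
    rintro x ⟨v, s⟩
    rw [mfderiv_snd]
    exact congrArg Prod.snd (totalJ_apply x v s)

theorem fibreJ_apply (t : Δ) (m : KT) (v : Fin 4 → ℝ) :
    fibreJ t m v = coordJ t (lift m) v := by
  have h1 : mfderiv 𝓘(ℝ, Fin 4 → ℝ) (𝓘(ℝ, Fin 4 → ℝ).prod 𝓘(ℝ, ℂ)) (fibreIncl t) m =
      ContinuousLinearMap.inl ℝ (Fin 4 → ℝ) ℂ := mfderiv_prod_left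
  have h2 : mfderiv (𝓘(ℝ, Fin 4 → ℝ).prod 𝓘(ℝ, ℂ)) 𝓘(ℝ, Fin 4 → ℝ) Prod.fst (fibreIncl t m) =
      ContinuousLinearMap.fst ℝ (Fin 4 → ℝ) ℂ := mfderiv_fst
  rw [fibreJ, h1, h2]
  exact congrArg Prod.fst (totalJ_apply (fibreIncl t m) v 0)

theorem contMDiff_fibreIncl (t : Δ) :
    ContMDiff 𝓘(ℝ, Fin 4 → ℝ) (𝓘(ℝ, Fin 4 → ℝ).prod 𝓘(ℝ, ℂ)) ∞ (fibreIncl t) :=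
  contMDiff_id.prodMk contMDiff_const

theorem isAlmostComplexStructure_fibreJ (t : Δ) :
    AlmostComplex.IsAlmostComplexStructure 𝓘(ℝ, Fin 4 → ℝ) (fibreJ t) where
  sq_eq_neg := fun m v => (congrArg (fibreJ t m) (fibreJ_apply t m v)).trans
    ((fibreJ_apply t m _).trans (coordJ_coordJ t _ v))
  smooth := by
    have h1 := (contMDiff_fibreIncl t).contMDiff_tangentMap (m := ∞) le_rfl
    have h2 := (contMDiff_fst (I := 𝓘(ℝ, Fin 4 → ℝ)) (J := 𝓘(ℝ, ℂ)) (M := KT) (N := Δ)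
      (n := ∞)).contMDiff_tangentMap (m := ∞) le_rfl
    -- By definition the fibre structure is the tangent map of the inclusion, followed by the total
    -- structure and the tangent map of the projection.
    exact h2.comp (contMDiff_totalJ.comp h1)

theorem isPseudoholomorphic_fibreIncl (t : Δ) :
    AlmostComplex.IsPseudoholomorphic 𝓘(ℝ, Fin 4 → ℝ) (𝓘(ℝ, Fin 4 → ℝ).prod 𝓘(ℝ, ℂ))
      (fibreJ t) totalJ (fibreIncl t) where
  smooth := contMDiff_fibreIncl t
  comm := by
    intro m v
    have h1 : mfderiv 𝓘(ℝ, Fin 4 → ℝ) (𝓘(ℝ, Fin 4 → ℝ).prod 𝓘(ℝ, ℂ)) (fibreIncl t) m =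
      ContinuousLinearMap.inl ℝ (Fin 4 → ℝ) ℂ := mfderiv_prod_left
    rw [h1]
    refine Eq.trans ?_ (totalJ_apply (fibreIncl t m) v 0).symm
    rw [mul_zero]
    exact Prod.ext (fibreJ_apply t m v) rfl

/-! ### Functions on the Kodaira–Thurston manifold -/

theorem contMDiffAt_of_contDiffAt_comp_proj {f : KT → ℂ} {m : KT}
    (hf : ContDiffAt ℝ ∞ (f ∘ proj) (lift m)) :
    ContMDiffAt 𝓘(ℝ, Fin 4 → ℝ) 𝓘(ℝ, ℂ) ∞ f m := by
  have h1 : ContDiffAt ℝ ∞ (f ∘ proj) (extChartAt 𝓘(ℝ, Fin 4 → ℝ) m m) := by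
    rwa [extChartAt_self]
  have h2 := h1.comp_contMDiffAt (contMDiffAt_extChartAt (I := 𝓘(ℝ, Fin 4 → ℝ)) (x := m))
  refine h2.congr_of_eventuallyEq ?_
  filter_upwards [(chart (lift m)).open_source.mem_nhds (mem_chart_source _ m)] with q hq
  simp only [Function.comp, extChartAt_eq]
  rw [proj_chart _ hq]

theorem contDiffOn_comp_proj {f : KT → ℂ} {U : Set KT}
    (hf : ContMDiffOn 𝓘(ℝ, Fin 4 → ℝ) 𝓘(ℝ, ℂ) ∞ f U) :
    ContDiffOn ℝ ∞ (f ∘ proj) (proj ⁻¹' U) :=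
  (hf.comp contMDiff_proj.contMDiffOn subset_rfl).contDiffOn

theorem diffFun_dproj {f : KT → ℂ} {p : Fin 4 → ℝ}
    (hf : MDifferentiableAt 𝓘(ℝ, Fin 4 → ℝ) 𝓘(ℝ, ℂ) f (proj p)) (v : Fin 4 → ℝ) :
    diffFun f (proj p) (dproj p v) = fderiv ℝ (f ∘ proj) p v := by
  obtain ⟨A, hA⟩ : ∃ A : (Fin 4 → ℝ) →L[ℝ] ℂ, A = diffFun f (proj p) := ⟨_, rfl⟩
  have h1 : HasMFDerivAt 𝓘(ℝ, Fin 4 → ℝ) 𝓘(ℝ, ℂ) f (proj p) A := by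
    rw [hA]
    exact hf.hasMFDerivAt
  have h2 : HasFDerivAt (f ∘ proj) (A.comp (dproj p)) p :=
    (HasMFDerivAt.comp p h1 (hasMFDerivAt_proj p)).hasFDerivAt
  rw [h2.fderiv, hA]
  rfl

theorem dbarFun_dproj (t : Δ) {f : KT → ℂ} {p : Fin 4 → ℝ}
    (hf : MDifferentiableAt 𝓘(ℝ, Fin 4 → ℝ) 𝓘(ℝ, ℂ) f (proj p)) (v : Fin 4 → ℝ) :
    dbarFun (fibreJ t) f (proj p) (dproj p v) =
      1 / 2 * (fderiv ℝ (f ∘ proj) p v + Complex.I * fderiv ℝ (f ∘ proj) p (coordJ t p v)) := by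
  have h1 : fibreJ t (proj p) (dproj p v) = dproj p (coordJ t p v) :=
    (fibreJ_apply t (proj p) (dproj p v)).trans (dproj_coordJ t p v).symm
  have h2 : diffFun f (proj p) (fibreJ t (proj p) (dproj p v)) =
      fderiv ℝ (f ∘ proj) p (coordJ t p v) :=
    (congrArg (diffFun f (proj p)) h1).trans (diffFun_dproj hf _)
  exact congrArg₂ (fun a b => (1 / 2 : ℂ) * (a + Complex.I * b)) (diffFun_dproj hf v) h2

theorem dbarFun_eq (t : Δ) {f : KT → ℂ} {m : KT}
    (hf : MDifferentiableAt 𝓘(ℝ, Fin 4 → ℝ) 𝓘(ℝ, ℂ) f m) (v : Fin 4 → ℝ) :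
    dbarFun (fibreJ t) f m v = 1 / 2 * (fderiv ℝ (f ∘ proj) (lift m) v +
      Complex.I * fderiv ℝ (f ∘ proj) (lift m) (coordJ t (lift m) v)) := by
  -- Quantifying over all `p` above `m` allows `m` to be eliminated; the statement is then used at
  -- `p = lift m`, where `dproj` is the identity.
  have h : ∀ p, proj p = m → dbarFun (fibreJ t) f m (dproj p v) = 1 / 2 *
      (fderiv ℝ (f ∘ proj) p v + Complex.I * fderiv ℝ (f ∘ proj) p (coordJ t p v)) := by
    rintro p rfl
    exact dbarFun_dproj t hf v
  exact (congrArg (dbarFun (fibreJ t) f m) (dproj_lift m v)).symm.trans (h _ (proj_lift m))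

/-! ### The frame of the canonical bundle -/

/-- The exterior product of two complex valued covectors. -/
noncomputable def wedge (α β : (Fin 4 → ℝ) →L[ℝ] ℂ) : (Fin 4 → ℝ) [⋀^Fin 2]→L[ℝ] ℂ :=
  ContinuousAlternatingMap.alternatizeUncurryFin
    (α.smulRight (ContinuousAlternatingMap.ofSubsingleton ℝ (Fin 4 → ℝ) ℂ (0 : Fin 1) β))

theorem wedge_apply (α β : (Fin 4 → ℝ) →L[ℝ] ℂ) (w : Fin 2 → Fin 4 → ℝ) :
    wedge α β w = α (w 0) * β (w 1) - α (w 1) * β (w 0) := by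
  simp [wedge, ContinuousAlternatingMap.alternatizeUncurryFin_apply, Fin.sum_univ_succ,
    Fin.removeNth]
  ring

/-- The covector `e¹ + i e²`. -/
noncomputable def φ₁ : (Fin 4 → ℝ) →L[ℝ] ℂ :=
  Complex.ofRealCLM.comp (ContinuousLinearMap.proj 3) +
    Complex.I • Complex.ofRealCLM.comp (ContinuousLinearMap.proj 0)

theorem φ₁_apply (v : Fin 4 → ℝ) : φ₁ v = v 3 + Complex.I * v 0 := by
  simp [φ₁]

/-- The coefficient of `e⁴` in the covector `φ₂` of type `(1, 0)`. -/
noncomputable def κ (t : ℂ) : ℂ := Complex.I * starRingEnd ℂ (t + Real.pi)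

/-- The covector `e³ + κ e⁴` at the point of `G` with coordinates `p`. -/
noncomputable def φ₂ (t : ℂ) (p v : Fin 4 → ℝ) : ℂ := v 1 + κ t * (v 2 - p 0 * v 1)

/-- The left invariant form `φ₁ ∧ φ₂` on `G`. -/
noncomputable def canonicalForm (t : ℂ) (p : Fin 4 → ℝ) : (Fin 4 → ℝ) [⋀^Fin 2]→L[ℝ] ℂ :=
  wedge φ₁ (Complex.ofRealCLM.comp (ContinuousLinearMap.proj 1) +
      κ t • Complex.ofRealCLM.comp (ContinuousLinearMap.proj 2)) +
    p 0 • wedge φ₁ (-κ t • Complex.ofRealCLM.comp (ContinuousLinearMap.proj 1))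

theorem canonicalForm_apply (t : ℂ) (p : Fin 4 → ℝ) (w : Fin 2 → Fin 4 → ℝ) :
    canonicalForm t p w = φ₁ (w 0) * φ₂ t p (w 1) - φ₁ (w 1) * φ₂ t p (w 0) := by
  simp [canonicalForm, wedge_apply, φ₂]
  ring

/-- Since e⁴ = dz - x dy, the form is affine in x, and its definition displays the constant and the
linear part separately. -/
theorem contDiff_canonicalForm (t : ℂ) : ContDiff ℝ ∞ (canonicalForm t) :=
  contDiff_const.add ((ContinuousLinearMap.proj 0 : (Fin 4 → ℝ) →L[ℝ] ℝ).contDiff.smul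
    contDiff_const)

theorem hasFDerivAt_canonicalForm_apply (t : ℂ) (p : Fin 4 → ℝ) (w : Fin 2 → Fin 4 → ℝ) :
    HasFDerivAt (fun q => canonicalForm t q w) ((ContinuousLinearMap.proj (R := ℝ)
      (φ := fun _ : Fin 4 => ℝ) 0).smulRight (-κ t * (φ₁ (w 0) * w 1 1 - φ₁ (w 1) * w 0 1))) p := by
  have h : (fun q => canonicalForm t q w) = fun q => canonicalForm t 0 w +
      q 0 • (-κ t * (φ₁ (w 0) * w 1 1 - φ₁ (w 1) * w 0 1)) := by
    funext q
    simp [canonicalForm_apply, φ₂]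
    ring
  rw [h]
  exact ((hasFDerivAt_apply 0 p).smul_const _).const_add _

/-- The global frame `φ₁ ∧ φ₂` of the canonical bundle of the fibre over `t`. -/
noncomputable def canonicalSection (t : ℂ) (m : KT) : FormFibre (Fin 4 → ℝ) 2 m :=
  canonicalForm t (lift m)

theorem φ₁_dproj (p v : Fin 4 → ℝ) : φ₁ (dproj p v) = φ₁ v := by
  obtain ⟨k, -, h⟩ := exists_dproj_eq p
  simp [φ₁_apply, h]

theorem φ₂_dproj (t : ℂ) (p v : Fin 4 → ℝ) : φ₂ t (lift (proj p)) (dproj p v) = φ₂ t p v := by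
  obtain ⟨k, hk, h⟩ := exists_dproj_eq p
  have h0 : p 0 = k 0 + lift (proj p) 0 := by conv_lhs => rw [hk]; simp [coordMul]
  rw [h]
  simp [φ₂, h0]
  ring_nf
  simp

theorem formInChart_apply {k : ℕ} (ψ : ∀ x : KT, FormFibre (Fin 4 → ℝ) k x) (x₀ : KT)
    (y : Fin 4 → ℝ) (w : Fin k → Fin 4 → ℝ) :
    formInChart ψ x₀ y w = ψ (proj y) (fun i => dproj y (w i)) := by
  rw [formInChart, extChartAt_symm_eq]
  rfl

/-- Both covectors are invariant under lattice translations, so the section has the same coordinate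
expression in all charts. -/
theorem formInChart_canonicalSection (t : ℂ) (x₀ : KT) :
    formInChart (canonicalSection t) x₀ = canonicalForm t := by
  funext y
  ext w
  rw [formInChart_apply, canonicalForm_apply]
  refine (canonicalForm_apply t (lift (proj y)) (fun i => dproj y (w i))).trans ?_
  simp only [φ₁_dproj, φ₂_dproj]

theorem extDerivAt_apply {k : ℕ} (ψ : ∀ x : KT, FormFibre (Fin 4 → ℝ) k x) (x : KT)
    (w : Fin (k + 1) → Fin 4 → ℝ) :
    extDerivAt ψ x w = extDeriv (formInChart ψ x) (lift x) w := by
  rw [extDerivAt, mfderiv_extChartAt_self, extChartAt_self]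
  rfl

theorem φ₁_coordJ (t p v) : φ₁ (coordJ t p v) = Complex.I * φ₁ v := by
  simp [φ₁_apply, coordJ]
  ring_nf
  simp

theorem κ_eq (t : ℂ) : κ t = t.im + Complex.I * (t.re + Real.pi) := by
  apply Complex.ext <;> simp [κ]

/-- This determines κ: on e₃ it reads (-Im t + κ)/(Re t + π) = i. The condition on e₄ then follows
from |κ|² = |t + π|². -/
theorem φ₂_coordJ (t : Δ) (p v) : φ₂ t p (coordJ t p v) = Complex.I * φ₂ t p v := by
  have h : ((t : ℂ).re + Real.pi : ℂ) ≠ 0 := by exact_mod_cast (Δ_re_pos t).ne'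
  simp [φ₂, κ_eq, coordJ, norm_add_pi_sq, -Complex.ofReal_pow]
  push_cast
  field_simp
  ring_nf
  simp
  ring

/-- A complex linear functional is determined by its values on `e₁` and `e₃`. -/
theorem apply_eq_of_complexLinear (t : Δ) (p : Fin 4 → ℝ) (ℓ : (Fin 4 → ℝ) →ₗ[ℝ] ℂ)
    (hℓ : ∀ v, ℓ (coordJ t p v) = Complex.I * ℓ v) (v : Fin 4 → ℝ) :
    ℓ v = φ₁ v * ℓ (field 0 p) + φ₂ t p v * ℓ (field 2 p) := by
  have h := (Δ_re_pos t).ne'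
  have h1 : v = v 3 • field 0 p + v 0 • coordJ t p (field 0 p) +
      (v 1 + (t : ℂ).im * (v 2 - p 0 * v 1)) • field 2 p +
      (((t : ℂ).re + Real.pi) * (v 2 - p 0 * v 1)) • coordJ t p (field 2 p) := by
    funext j
    fin_cases j <;> simp [coordJ, field]
    all_goals field_simp
    all_goals ring
  conv_lhs => rw [h1]
  simp only [map_add, map_smul, hℓ, Complex.real_smul, φ₁_apply, φ₂, κ_eq]
  push_cast
  ring

/-! ### Forms of type `(2, 0)` and the operator `∂̄` -/

theorem field_zero_coords (p : Fin 4 → ℝ) : field 0 p = ![0, 0, 0, 1] := rfl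
theorem field_two_coords (p : Fin 4 → ℝ) : field 2 p = ![0, 1, p 0, 0] := rfl

theorem apply_eq_neg_swap (A : (Fin 4 → ℝ) [⋀^Fin 2]→L[ℝ] ℂ) (a b : Fin 4 → ℝ) :
    A ![b, a] = -A ![a, b] := by
  have h := A.toAlternatingMap.map_swap ![a, b] (zero_ne_one : (0 : Fin 2) ≠ 1)
  have h2 : ![a, b] ∘ Equiv.swap (0 : Fin 2) 1 = ![b, a] := by
    funext i
    fin_cases i <;> simp
  rwa [h2] at h

/-- Forms of type (2,0) form a complex line: e₁ and e₃ are a complex basis of the tangent space, and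
expanding both arguments in it leaves only the value on (e₁, e₃). -/
theorem eq_smul_canonicalForm (t : Δ) (p : Fin 4 → ℝ) (A : (Fin 4 → ℝ) [⋀^Fin 2]→L[ℝ] ℂ)
    (hA : ∀ w i, A (Function.update w i (coordJ t p (w i))) = Complex.I * A w) :
    A = A ![field 0 p, field 2 p] • canonicalForm t p := by
  have h1 : ∀ a b, A ![a, b] = φ₁ b * A ![a, field 0 p] + φ₂ t p b * A ![a, field 2 p] := by
    intro a b
    have h : ∀ v, A.toMultilinearMap.toLinearMap ![a, 0] 1 v = A ![a, v] := by
      intro v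
      change A _ = A _
      congr 1
      funext i
      fin_cases i <;> simp
    have h' := apply_eq_of_complexLinear t p (A.toMultilinearMap.toLinearMap ![a, 0] 1)
      (fun v => by
        rw [h, h, ← hA ![a, v] 1]
        congr 1
        funext i
        fin_cases i <;> simp) b
    rwa [h, h, h] at h'
  have h0 : ∀ a, A ![a, a] = 0 := fun a =>
    A.map_eq_zero_of_eq ![a, a] (i := 0) (j := 1) rfl zero_ne_one
  ext w
  have hw : w = ![w 0, w 1] := by
    funext i
    fin_cases i <;> rfl
  rw [hw, h1, apply_eq_neg_swap A (field 0 p), apply_eq_neg_swap A (field 2 p), h1 (field 0 p),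
    h1 (field 2 p), h0, h0, apply_eq_neg_swap A (field 0 p)]
  simp [canonicalForm_apply]
  ring

theorem eq_smul_canonicalSection (t : Δ) (m : KT) (A : FormFibre (Fin 4 → ℝ) 2 m)
    (hA : IsTypeZero (fibreJ t) m A) :
    A = A (![field 0 (lift m), field 2 (lift m)] : Fin 2 → Fin 4 → ℝ) • canonicalSection t m :=
  eq_smul_canonicalForm t (lift m) A fun w i =>
    (congrArg (fun v => A (Function.update w i v)) (fibreJ_apply t m (w i)).symm).trans (hA w i)

theorem canonicalForm_update (t : Δ) (p : Fin 4 → ℝ) (w : Fin 2 → Fin 4 → ℝ) (i : Fin 2) :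
    canonicalForm t p (Function.update w i (coordJ t p (w i))) =
      Complex.I * canonicalForm t p w := by
  rw [canonicalForm_apply, canonicalForm_apply]
  fin_cases i <;> simp [φ₁_coordJ, φ₂_coordJ] <;> ring

theorem isTypeZero_canonicalSection (t : Δ) (m : KT) :
    IsTypeZero (fibreJ t) m (canonicalSection t m) := fun w i =>
  (congrArg (fun v => canonicalForm t (lift m) (Function.update w i v))
    (fibreJ_apply t m (w i))).trans (canonicalForm_update t (lift m) w i)

theorem canonicalForm_field (t : Δ) (p : Fin 4 → ℝ) :
    canonicalForm t p ![field 0 p, field 2 p] = 1 := by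
  simp [canonicalForm_apply, φ₁_apply, φ₂, field_zero_coords, field_two_coords]

theorem projTypeZero_apply (t : Δ) (m : KT) (A : (Fin 4 → ℝ) [⋀^Fin 2]→L[ℝ] ℂ)
    (a b : Fin 4 → ℝ) :
    projTypeZero (fibreJ t) m A (![a, b] : Fin 2 → Fin 4 → ℝ) =
      1 / 4 * (A ![a, b] - Complex.I * A ![coordJ t (lift m) a, b] -
        Complex.I * A ![a, coordJ t (lift m) b] -
        A ![coordJ t (lift m) a, coordJ t (lift m) b]) := by
  have hJ : ∀ v : Fin 4 → ℝ, (fibreJ t m v : Fin 4 → ℝ) = coordJ t (lift m) v := fibreJ_apply t m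
  have h1 : ∀ S : Finset (Fin 2), (A : (Fin 2 → Fin 4 → ℝ) → ℂ)
      (fun i => if i ∈ S then fibreJ t m ((![a, b] : Fin 2 → Fin 4 → ℝ) i)
        else (![a, b] : Fin 2 → Fin 4 → ℝ) i) =
      A ![if 0 ∈ S then coordJ t (lift m) a else a, if 1 ∈ S then coordJ t (lift m) b else b] := by
    intro S
    congr 1
    funext i
    fin_cases i
    · exact congrArg (fun v => if 0 ∈ S then v else a) (hJ a)
    · exact congrArg (fun v => if 1 ∈ S then v else b) (hJ b)
  have h2 : (Finset.univ : Finset (Finset (Fin 2))) = {∅, {0}, {1}, {0, 1}} := by decide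
  refine (projMultilinear_apply (fibreJ t) m A _).trans
    ((Finset.sum_congr rfl fun S _ => congrArg _ (h1 S)).trans ?_)
  rw [h2, Finset.sum_insert (by decide), Finset.sum_insert (by decide),
    Finset.sum_insert (by decide), Finset.sum_singleton]
  simp
  ring

/-- The projection does land in type (2,0): replacing an argument by its image under J permutes the
four terms up to factors ±i, by J² = -1. -/
theorem projTypeZero_eq (t : Δ) (m : KT) (A : (Fin 4 → ℝ) [⋀^Fin 2]→L[ℝ] ℂ) :
    projTypeZero (fibreJ t) m A =
      (projTypeZero (fibreJ t) m A (![field 0 (lift m), field 2 (lift m)] : Fin 2 → Fin 4 → ℝ)) •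
        canonicalSection t m := by
  obtain ⟨B, hB⟩ : ∃ B : (Fin 4 → ℝ) [⋀^Fin 2]→L[ℝ] ℂ, B = projTypeZero (fibreJ t) m A :=
    ⟨_, rfl⟩
  have h1 : ∀ a b, B ![a, b] = 1 / 4 * (A ![a, b] - Complex.I * A ![coordJ t (lift m) a, b] -
        Complex.I * A ![a, coordJ t (lift m) b] -
        A ![coordJ t (lift m) a, coordJ t (lift m) b]) := fun a b => by
    rw [hB]
    exact projTypeZero_apply t m A a b
  have hn : ∀ a b, A ![-a, b] = -A ![a, b] := fun a b => by
    have h := A.toMultilinearMap.map_update_smul ![a, b] 0 (-1 : ℝ) a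
    have e1 : Function.update ![a, b] 0 ((-1 : ℝ) • a) = ![-a, b] := by
      funext i; fin_cases i <;> simp
    have e2 : Function.update ![a, b] 0 a = ![a, b] := by funext i; fin_cases i <;> simp
    rw [e1, e2] at h
    exact h.trans (by rw [neg_one_smul]; rfl)
  have hn' : ∀ a b, A ![a, -b] = -A ![a, b] := fun a b => by
    rw [apply_eq_neg_swap A (-b), hn, apply_eq_neg_swap A a, neg_neg]
  rw [← hB]
  refine eq_smul_canonicalForm t (lift m) B fun w i => ?_
  have hw : w = ![w 0, w 1] := by
    funext i
    fin_cases i <;> rfl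
  have e1 : ∀ v, Function.update w 0 v = ![v, w 1] := fun v => by
    funext i; fin_cases i <;> simp
  have e2 : ∀ v, Function.update w 1 v = ![w 0, v] := fun v => by
    funext i; fin_cases i <;> simp
  have hI := Complex.I_mul_I
  conv_rhs => rw [hw, h1]
  fin_cases i
  · simp only [Fin.zero_eta, e1]
    rw [h1, coordJ_coordJ, hn, hn]
    linear_combination (1 / 4 * (A ![coordJ t (lift m) (w 0), w 1] +
      A ![w 0, coordJ t (lift m) (w 1)])) * hI
  · simp only [Fin.mk_one, e2]
    rw [h1, coordJ_coordJ, hn', hn']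
    linear_combination (1 / 4 * (A ![coordJ t (lift m) (w 0), w 1] +
      A ![w 0, coordJ t (lift m) (w 1)])) * hI

/-- The Leibniz rule dg ∧ Φ + g dΦ, where dΦ = -κ dx ∧ φ₁ ∧ dy comes from the x in e⁴ = dz - x dy.
-/
theorem extDeriv_smul_canonicalForm {t : ℂ} {p : Fin 4 → ℝ}
    {α : (Fin 4 → ℝ) → (Fin 4 → ℝ) [⋀^Fin 2]→L[ℝ] ℂ} {g : (Fin 4 → ℝ) → ℂ}
    {g' : (Fin 4 → ℝ) →L[ℝ] ℂ} (hα : α =ᶠ[𝓝 p] fun y => g y • canonicalForm t y)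
    (hg : HasFDerivAt g g' p) (a b c : Fin 4 → ℝ) :
    extDeriv α p ![a, b, c] =
      g' a * canonicalForm t p ![b, c] - g' b * canonicalForm t p ![a, c] +
        g' c * canonicalForm t p ![a, b] -
      g p * κ t * (a 0 * (φ₁ b * c 1 - φ₁ c * b 1) - b 0 * (φ₁ a * c 1 - φ₁ c * a 1) +
        c 0 * (φ₁ a * b 1 - φ₁ b * a 1)) := by
  have hd : DifferentiableAt ℝ (fun y => g y • canonicalForm t y) p :=
    hg.differentiableAt.smul ((contDiff_canonicalForm t).differentiable (by simp) p)
  have h1 : ∀ (w : Fin 2 → Fin 4 → ℝ) (u : Fin 4 → ℝ),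
      fderiv ℝ (fun y => (g y • canonicalForm t y) w) p u =
        g' u * canonicalForm t p w -
          g p * κ t * u 0 * (φ₁ (w 0) * w 1 1 - φ₁ (w 1) * w 0 1) := by
    intro w u
    have h2 := (hg.mul (hasFDerivAt_canonicalForm_apply t p w)).fderiv
    refine (DFunLike.congr_fun h2 u).trans ?_
    simp
    ring
  have e0 : Fin.removeNth 0 ![a, b, c] = ![b, c] := by
    funext i; fin_cases i <;> rfl
  have e1 : Fin.removeNth 1 ![a, b, c] = ![a, c] := by
    funext i; fin_cases i <;> rfl
  have e2 : Fin.removeNth 2 ![a, b, c] = ![a, b] := by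
    funext i; fin_cases i <;> rfl
  rw [hα.extDeriv_eq, extDeriv_apply hd, Fin.sum_univ_three, h1, h1, h1, e0, e1, e2]
  simp
  ring

/-- The constant `c` with `∂̄(φ₁ ∧ φ₂) = c φ̄₁ ⊗ (φ₁ ∧ φ₂)`. -/
noncomputable def dbarConst (t : ℂ) : ℝ := ‖t + Real.pi‖ ^ 2 / (4 * (t.re + Real.pi))

theorem dbarForm_eq_projTypeZero (t : Δ) (ψ : ∀ x : KT, FormFibre (Fin 4 → ℝ) 2 x) (m : KT)
    (v : Fin 4 → ℝ) : ∃ B : (Fin 4 → ℝ) [⋀^Fin 2]→L[ℝ] ℂ,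
      dbarForm (fibreJ t) ψ m v = projTypeZero (fibreJ t) m B ∧
      ∀ a b, B ![a, b] = 1 / 2 * (extDeriv (formInChart ψ m) (lift m) ![v, a, b] +
        Complex.I * extDeriv (formInChart ψ m) (lift m) ![coordJ t (lift m) v, a, b]) := by
  obtain ⟨η, hη⟩ : ∃ η : (Fin 4 → ℝ) [⋀^Fin 3]→L[ℝ] ℂ, η = extDerivAt ψ m := ⟨_, rfl⟩
  have h1 : ∀ w, η w = extDeriv (formInChart ψ m) (lift m) w := fun w => by
    rw [hη]
    exact extDerivAt_apply ψ m w
  refine ⟨(1 / 2 : ℂ) • (η.curryLeft v + Complex.I • η.curryLeft (coordJ t (lift m) v)), ?_, ?_⟩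
  · rw [hη]
    exact congrArg (fun u : Fin 4 → ℝ => projTypeZero (fibreJ t) m ((1 / 2 : ℂ) •
      (ContinuousAlternatingMap.curryLeft (E := Fin 4 → ℝ) (extDerivAt ψ m) v +
        Complex.I • ContinuousAlternatingMap.curryLeft (E := Fin 4 → ℝ) (extDerivAt ψ m) u)))
      (fibreJ_apply t m v)
  · intro a b
    simp only [ContinuousAlternatingMap.smul_apply, ContinuousAlternatingMap.add_apply,
      ContinuousAlternatingMap.curryLeft_apply_apply, h1, smul_eq_mul]

/-- This is ∂̄(gΦ) = ∂̄g ⊗ Φ + g c φ̄₁ ⊗ Φ. A (2,0)-form is determined by its value on (e₁, e₃), so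
only one coefficient has to be computed. -/
theorem dbarForm_eq_smul (t : Δ) {ψ : ∀ x : KT, FormFibre (Fin 4 → ℝ) 2 x} {m : KT}
    {g : (Fin 4 → ℝ) → ℂ} {g' : (Fin 4 → ℝ) →L[ℝ] ℂ}
    (hψ : formInChart ψ m =ᶠ[𝓝 (lift m)] fun y => g y • canonicalForm t y)
    (hg : HasFDerivAt g g' (lift m)) (v : Fin 4 → ℝ) :
    dbarForm (fibreJ t) ψ m v = (1 / 2 * (g' v + Complex.I * g' (coordJ t (lift m) v)) +
      g (lift m) * dbarConst t * starRingEnd ℂ (φ₁ v)) • canonicalSection t m := by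
  obtain ⟨B, hB, hB'⟩ := dbarForm_eq_projTypeZero t ψ m v
  rw [hB, projTypeZero_eq]
  congr 1
  rw [projTypeZero_apply]
  simp only [hB', extDeriv_smul_canonicalForm hψ hg]
  have hre := (Δ_re_pos t).ne'
  set p := lift m
  have hI := Complex.I_mul_I
  have h00 : φ₁ (field 0 p) = 1 := by simp [φ₁_apply, field_zero_coords]
  have h10 : φ₁ (field 2 p) = 0 := by simp [φ₁_apply, field_two_coords]
  have h20 : φ₂ t p (field 0 p) = 0 := by simp [φ₂, field_zero_coords]
  have h22 : φ₂ t p (field 2 p) = 1 := by simp [φ₂, field_two_coords]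
  have k0 : coordJ t p (field 0 p) 0 = 1 := by simp [coordJ, field_zero_coords]
  have k1 : coordJ t p (field 0 p) 1 = 0 := by simp [coordJ, field_zero_coords]
  have k2 : coordJ t p (field 2 p) 0 = 0 := by simp [coordJ, field_two_coords]
  have k3 : coordJ t p (field 2 p) 1 = -((t : ℂ).im / ((t : ℂ).re + Real.pi)) := by
    simp [coordJ, field_two_coords]
  have k4 : coordJ t p v 0 = v 3 := rfl
  have l0 : field 0 p 0 = 0 := rfl
  have l1 : field 0 p 1 = 0 := rfl
  have l2 : field 2 p 0 = 0 := rfl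
  have l3 : field 2 p 1 = 1 := rfl
  simp only [canonicalForm_apply, Matrix.cons_val_zero, Matrix.cons_val_one, φ₁_coordJ,
    φ₂_coordJ, h00, h10, h20, h22, k0, k1, k2, k3, k4, l0, l1, l2, l3]
  -- The six values of `g'` may be treated as independent: those on e₁, e₃ and their images under J
  -- cancel, since Φ vanishes when contracted with a (0,1)-vector.
  generalize g' v = x1
  generalize g' (coordJ t p v) = x2
  generalize g' (field 0 p) = x3
  generalize g' (field 2 p) = x4
  generalize g' (coordJ t p (field 0 p)) = x5
  generalize g' (coordJ t p (field 2 p)) = x6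
  -- With a = Re t + π and q = Im t / a one has κ = a (q + i) and 4c = a (q² + 1), so the identity
  -- becomes polynomial in a, q and i.
  obtain ⟨q, hq⟩ : ∃ q : ℝ, q = (t : ℂ).im / ((t : ℂ).re + Real.pi) := ⟨_, rfl⟩
  obtain ⟨a, ha⟩ : ∃ a : ℝ, a = (t : ℂ).re + Real.pi := ⟨_, rfl⟩
  have him : (t : ℂ).im = q * a := by rw [hq, ha]; field_simp
  have hκ : κ t = a * (q + Complex.I) := by
    rw [κ_eq, him, ha]
    push_cast
    ring
  have hc : (dbarConst t : ℂ) = a * (q ^ 2 + 1) / 4 := by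
    rw [dbarConst, norm_add_pi_sq, him, ← ha]
    rw [← ha] at hre
    have : (a : ℂ) ≠ 0 := by exact_mod_cast hre
    push_cast
    field_simp
    ring
  have hconj : starRingEnd ℂ (φ₁ v) = v 3 - Complex.I * v 0 := by
    rw [φ₁_apply]
    simp
    ring
  rw [hκ, hc, hconj, φ₁_apply v, ← hq]
  push_cast
  have hI2 : Complex.I ^ 2 = -1 := Complex.I_sq
  have hI3 : Complex.I ^ 3 = -Complex.I := by rw [pow_succ, hI2]; ring
  have hI4 : Complex.I ^ 4 = 1 := by rw [pow_succ, hI3]; linear_combination -hI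
  have hI5 : Complex.I ^ 5 = Complex.I := by rw [pow_succ, hI4, one_mul]
  ring_nf
  simp only [hI2, hI3, hI4, hI5]
  ring

/-! ### Pluricanonical sections of the fibres -/

theorem isCanonicalFrameOn_canonicalSection (t : Δ) :
    IsCanonicalFrameOn (fibreJ t) (canonicalSection t) univ where
  smooth := fun x₀ => by
    rw [formInChart_canonicalSection]
    exact (contDiff_canonicalForm t).contDiffOn
  type_zero := fun m _ => isTypeZero_canonicalSection t m
  ne_zero := fun m _ h => by
    have h1 := canonicalForm_field t (lift m)
    have h2 : canonicalForm t (lift m) = 0 := h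
    rw [h2] at h1
    simp at h1

theorem formPow_canonicalSection_ne_zero (t : Δ) (k : ℕ) (m : KT) :
    formPow k (canonicalSection t) m ≠ 0 := by
  let ev : FormFibre (Fin 4 → ℝ) 2 m →ₗ[ℂ] ℂ :=
    { toFun := fun A => A (![field 0 (lift m), field 2 (lift m)] : Fin 2 → Fin 4 → ℝ)
      map_add' := fun _ _ => rfl
      map_smul' := fun _ _ => rfl }
  have h1 : ev (canonicalSection t m) = 1 := canonicalForm_field t (lift m)
  intro h
  -- The functional induced by the product of `k` copies of `ev` takes the value 1 on this tensor
  -- power.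
  have h2 := congrArg (PiTensorProduct.lift
    ((MultilinearMap.mkPiAlgebra ℂ (Fin k) ℂ).compLinearMap fun _ => ev)) h
  rw [formPow, PiTensorProduct.lift.tprod, map_zero] at h2
  simp [h1] at h2

theorem formPow_of_eq_smul {ψ χ : ∀ x : KT, FormFibre (Fin 4 → ℝ) 2 x} {x : KT} {c : ℂ}
    (h : ψ x = c • χ x) (k : ℕ) : formPow k ψ x = c ^ k • formPow k χ x := by
  simp only [formPow, h]
  rw [MultilinearMap.map_smul_univ]
  simp

theorem dbarFormPow_of_eq_smul
    {J : ∀ x : KT, TangentSpace 𝓘(ℝ, Fin 4 → ℝ) x →L[ℝ] TangentSpace 𝓘(ℝ, Fin 4 → ℝ) x}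
    {ψ : ∀ x : KT, FormFibre (Fin 4 → ℝ) 2 x} {x : KT} {v : TangentSpace 𝓘(ℝ, Fin 4 → ℝ) x}
    {c : ℂ} (h : dbarForm J ψ x v = c • ψ x) (k : ℕ) :
    dbarFormPow J k ψ x v = (k * c) • formPow k ψ x := by
  have h1 : ∀ i : Fin k, PiTensorProduct.tprod ℂ
      (Function.update (fun _ : Fin k => ψ x) i (dbarForm J ψ x v)) = c • formPow k ψ x := by
    intro i
    rw [h, MultilinearMap.map_update_smul, Function.update_eq_self]
    rfl
  rw [dbarFormPow, Finset.sum_congr rfl fun i _ => h1 i]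
  simp [mul_smul, Nat.cast_smul_eq_nsmul]

theorem dbarForm_canonicalSection (t : Δ) (m : KT) (v : Fin 4 → ℝ) :
    dbarForm (fibreJ t) (canonicalSection t) m v =
      (dbarConst t * starRingEnd ℂ (φ₁ v)) • canonicalSection t m := by
  have h := dbarForm_eq_smul t (ψ := canonicalSection t) (m := m) (g := fun _ => 1) (g' := 0)
    (by rw [formInChart_canonicalSection]; simp) (hasFDerivAt_const _ _) v
  simpa using h

/-- The coefficient of a form with respect to the canonical frame. -/
noncomputable def frameCoeff (ψ : ∀ x : KT, FormFibre (Fin 4 → ℝ) 2 x) (x : KT) : ℂ :=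
  ψ x (![field 0 (lift x), field 2 (lift x)] : Fin 2 → Fin 4 → ℝ)

theorem frameCoeff_proj (ψ : ∀ x : KT, FormFibre (Fin 4 → ℝ) 2 x) (x₀ : KT) (y : Fin 4 → ℝ) :
    frameCoeff ψ (proj y) = formInChart ψ x₀ y ![field 0 y, field 2 y] := by
  rw [formInChart_apply, frameCoeff, ← dproj_field, ← dproj_field]
  congr 1
  funext i
  fin_cases i <;> rfl

/-- The arguments move with `y`, but e₃ at `y` is e₃ at 0 plus `y 0` times e₄, so by linearity only
evaluations on fixed vectors occur. -/
theorem contDiffAt_apply_field {F : (Fin 4 → ℝ) → (Fin 4 → ℝ) [⋀^Fin 2]→L[ℝ] ℂ} {p : Fin 4 → ℝ}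
    (hF : ContDiffAt ℝ ∞ F p) : ContDiffAt ℝ ∞ (fun y => F y ![field 0 y, field 2 y]) p := by
  have h1 : ∀ w, ContDiffAt ℝ ∞ (fun y => F y w) p := fun w =>
    (ContinuousAlternatingMap.apply ℝ (Fin 4 → ℝ) ℂ w).contDiff.contDiffAt.comp p hF
  have h2 : (fun y => F y ![field 0 y, field 2 y]) =
      fun y => F y ![field 0 0, field 2 0] + y 0 • F y ![field 0 0, field 3 0] := by
    funext y
    have e1 := (F y).toMultilinearMap.map_update_add ![field 0 y, 0] 1 (field 2 0)
      (y 0 • field 3 0)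
    rw [(F y).toMultilinearMap.map_update_smul] at e1
    have e2 : ∀ v, Function.update ![field 0 y, 0] 1 v = ![field 0 0, v] := fun v => by
      funext i; fin_cases i <;> rfl
    have e3 : field 2 0 + y 0 • field 3 0 = field 2 y := by
      funext i; fin_cases i <;> simp [field]
    rw [e2, e2, e2, e3] at e1
    exact e1
  rw [h2]
  exact (h1 _).add ((contDiff_apply ℝ ℝ (0 : Fin 4)).contDiffAt.smul (h1 _))

theorem contMDiffOn_frameCoeff {ψ : ∀ x : KT, FormFibre (Fin 4 → ℝ) 2 x} {U : Set KT}
    (hU : IsOpen U) (hψ : IsSmoothFormOn ψ U) :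
    ContMDiffOn 𝓘(ℝ, Fin 4 → ℝ) 𝓘(ℝ, ℂ) ∞ (frameCoeff ψ) U := by
  intro m hm
  refine (contMDiffAt_of_contDiffAt_comp_proj ?_).contMDiffWithinAt
  have h1 : ContDiffAt ℝ ∞ (formInChart ψ m) (lift m) := by
    refine (hψ m).contDiffAt (Filter.inter_mem ?_ ?_)
    · rw [extChartAt_target_eq]
      exact Metric.ball_mem_nhds _ (by norm_num)
    · rw [extChartAt_symm_eq]
      exact (hU.preimage continuous_proj).mem_nhds (by rwa [mem_preimage, proj_lift])
  rw [show frameCoeff ψ ∘ proj = fun y => formInChart ψ m y ![field 0 y, field 2 y] from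
    funext fun y => frameCoeff_proj ψ m y]
  exact contDiffAt_apply_field h1

theorem dbarForm_of_isCanonicalFrameOn (t : Δ) {ψ : ∀ x : KT, FormFibre (Fin 4 → ℝ) 2 x}
    {U : Set KT} (hU : IsOpen U) (hψ : IsCanonicalFrameOn (fibreJ t) ψ U) {m : KT} (hm : m ∈ U)
    (v : Fin 4 → ℝ) :
    dbarForm (fibreJ t) ψ m v = (dbarFun (fibreJ t) (frameCoeff ψ) m v +
      frameCoeff ψ m * dbarConst t * starRingEnd ℂ (φ₁ v)) • canonicalSection t m := by
  have hd : MDifferentiableAt 𝓘(ℝ, Fin 4 → ℝ) 𝓘(ℝ, ℂ) (frameCoeff ψ) m :=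
    ((contMDiffOn_frameCoeff hU hψ.smooth).contMDiffAt (hU.mem_nhds hm)).mdifferentiableAt
      (by simp)
  have hd2 : DifferentiableAt ℝ (frameCoeff ψ ∘ proj) (lift m) := by
    have h := contDiffOn_comp_proj (contMDiffOn_frameCoeff hU hψ.smooth)
    exact (h.contDiffAt ((hU.preimage continuous_proj).mem_nhds
      (by rwa [mem_preimage, proj_lift]))).differentiableAt (by simp)
  have h1 : formInChart ψ m =ᶠ[𝓝 (lift m)]
      fun y => (frameCoeff ψ ∘ proj) y • canonicalForm t y := by
    filter_upwards [(hU.preimage continuous_proj).mem_nhds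
      (show lift m ∈ proj ⁻¹' U by rwa [mem_preimage, proj_lift])] with y hy
    have h2 := eq_smul_canonicalSection t (proj y) (ψ (proj y)) (hψ.type_zero _ hy)
    rw [← formInChart_canonicalSection t m]
    ext w
    rw [formInChart_apply]
    refine (congrArg (fun A : (Fin 4 → ℝ) [⋀^Fin 2]→L[ℝ] ℂ => A fun i => dproj y (w i)) h2).trans ?_
    exact congrArg (fun z => frameCoeff ψ (proj y) * z) (formInChart_apply _ m y w).symm
  have h3 := dbarForm_eq_smul t h1 hd2.hasFDerivAt v
  rw [dbarFun_eq t hd]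
  simp only [Function.comp, proj_lift] at h3 ⊢
  exact h3

/-- The equation `∂̄(f (φ₁ ∧ φ₂)^k) = 0` for the coefficient `f`. -/
def IsSolution (t : Δ) (k : ℕ) (f : KT → ℂ) : Prop :=
  ContMDiff 𝓘(ℝ, Fin 4 → ℝ) 𝓘(ℝ, ℂ) ∞ f ∧ ∀ (x : KT) (v : Fin 4 → ℝ),
    dbarFun (fibreJ t) f x v + k * (dbarConst t * starRingEnd ℂ (φ₁ v)) * f x = 0

/-- Tests the section against the global frame Φ only; `mem_of_isSolution` shows that no other frame
adds a condition. -/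
theorem exists_isSolution_of_mem {t : Δ} {k : ℕ} {σ : ∀ x : KT, TensorFibre (Fin 4 → ℝ) 2 k x}
    (hσ : σ ∈ pluricanonicalSections (fibreJ t) 2 k) :
    ∃ f, IsSolution t k f ∧ ∀ x, σ x = f x • formPow k (canonicalSection t) x := by
  obtain ⟨f, hf, h⟩ := hσ univ _ isOpen_univ (isCanonicalFrameOn_canonicalSection t)
  refine ⟨f, ⟨contMDiffOn_univ.1 hf, fun x v => ?_⟩, fun x => (h x trivial).1⟩
  have h1 := (h x trivial).2 v
  have h2 := dbarFormPow_of_eq_smul (J := fibreJ t) (dbarForm_canonicalSection t x v) k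
  have h3 : (dbarFun (fibreJ t) f x v + k * (dbarConst t * starRingEnd ℂ (φ₁ v)) * f x) •
      formPow k (canonicalSection t) x = 0 := by
    rw [← h1]
    refine Eq.trans ?_ (congrArg (fun z => dbarFun (fibreJ t) f x v •
      formPow k (canonicalSection t) x + f x • z) h2.symm)
    simp only [smul_smul, add_smul]
    ring_nf
  exact (smul_eq_zero.1 h3).resolve_right (formPow_canonicalSection_ne_zero t k x)

theorem fderiv_mul_inv_pow {F G : (Fin 4 → ℝ) → ℂ} {p : Fin 4 → ℝ} (hF : DifferentiableAt ℝ F p)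
    (hG : DifferentiableAt ℝ G p) (h0 : G p ≠ 0) (k : ℕ) (v : Fin 4 → ℝ) :
    fderiv ℝ (fun y => F y * (G y ^ k)⁻¹) p v =
      (G p ^ k)⁻¹ * (fderiv ℝ F p v - k * F p * ((G p)⁻¹ * fderiv ℝ G p v)) := by
  have h1 : HasFDerivAt (fun y => (G y ^ k)⁻¹)
      ((-(k * (G p)⁻¹ * (G p ^ k)⁻¹)) • fderiv ℝ G p) p := by
    have h2 : HasDerivAt (fun z : ℂ => (z ^ k)⁻¹) (-(k * (G p)⁻¹ * (G p ^ k)⁻¹)) (G p) := by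
      refine ((hasDerivAt_pow k (G p)).inv (pow_ne_zero k h0)).congr_deriv ?_
      rcases k with _ | k
      · simp
      · simp
        field_simp
        ring
    have h3 := (h2.hasFDerivAt.restrictScalars ℝ).comp p hG.hasFDerivAt
    refine h3.congr_fderiv ?_
    ext v
    simp
    ring
  refine (DFunLike.congr_fun (hF.hasFDerivAt.mul h1).fderiv v).trans ?_
  simp
  ring

/-- In another frame ψ = gΦ the coefficient is f g⁻ᵏ. Its ∂̄ contributes -k f g⁻ᵏ g⁻¹ ∂̄g, which
cancels the g⁻¹ ∂̄g produced by each of the k factors of ψᵏ. -/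
theorem mem_of_isSolution {t : Δ} {k : ℕ} {f : KT → ℂ} (hf : IsSolution t k f) :
    (fun x => f x • formPow k (canonicalSection t) x) ∈
      pluricanonicalSections (fibreJ t) 2 k := by
  intro U ψ hU hψ
  have hg := contMDiffOn_frameCoeff hU hψ.smooth
  have hg' := contDiffOn_comp_proj hg
  have hF := contDiffOn_comp_proj (contMDiffOn_univ.2 hf.1)
  rw [preimage_univ] at hF
  have hψg : ∀ x ∈ U, ψ x = frameCoeff ψ x • canonicalSection t x := fun x hx =>
    eq_smul_canonicalSection t x (ψ x) (hψ.type_zero x hx)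
  have hg0 : ∀ x ∈ U, frameCoeff ψ x ≠ 0 := fun x hx h =>
    hψ.ne_zero x hx ((hψg x hx).trans (by rw [h]; exact zero_smul ℂ (canonicalSection t x)))
  have hnhds : ∀ x ∈ U, proj ⁻¹' U ∈ 𝓝 (lift x) := fun x hx =>
    (hU.preimage continuous_proj).mem_nhds (by rwa [mem_preimage, proj_lift])
  set q : KT → ℂ := fun x => f x * (frameCoeff ψ x ^ k)⁻¹ with hq
  have hqs : ∀ x ∈ U, ContMDiffAt 𝓘(ℝ, Fin 4 → ℝ) 𝓘(ℝ, ℂ) ∞ q x := by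
    intro x hx
    refine contMDiffAt_of_contDiffAt_comp_proj ?_
    refine (hF.contDiffAt Filter.univ_mem).mul
      ((((hg'.contDiffAt (hnhds x hx))).pow k).inv ?_)
    simpa [proj_lift] using pow_ne_zero k (hg0 x hx)
  refine ⟨q, fun x hx => (hqs x hx).contMDiffWithinAt, fun x hx => ?_⟩
  have hpow := formPow_of_eq_smul (hψg x hx) k
  have hk := pow_ne_zero k (hg0 x hx)
  refine ⟨?_, fun (v : Fin 4 → ℝ) => ?_⟩
  · rw [hpow, smul_smul, hq]
    field_simp
  · have h1 : dbarForm (fibreJ t) ψ x v = ((frameCoeff ψ x)⁻¹ *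
        (dbarFun (fibreJ t) (frameCoeff ψ) x v +
          frameCoeff ψ x * dbarConst t * starRingEnd ℂ (φ₁ v))) • ψ x := by
      refine (dbarForm_of_isCanonicalFrameOn t hU hψ hx v).trans ?_
      rw [hψg x hx, smul_smul]
      congr 1
      have := hg0 x hx
      field_simp
    rw [dbarFormPow_of_eq_smul h1, smul_smul, ← add_smul]
    have h2 : dbarFun (fibreJ t) q x v = (frameCoeff ψ x ^ k)⁻¹ * (dbarFun (fibreJ t) f x v -
        k * f x * ((frameCoeff ψ x)⁻¹ * dbarFun (fibreJ t) (frameCoeff ψ) x v)) := by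
      have e1 := dbarFun_eq t ((hqs x hx).mdifferentiableAt (by simp)) v
      have e2 := dbarFun_eq t (((hg.contMDiffAt (hU.mem_nhds hx))).mdifferentiableAt (by simp)) v
      have e3 := dbarFun_eq t (hf.1.contMDiffAt.mdifferentiableAt (x := x) (by simp)) v
      have e4 := fderiv_mul_inv_pow (p := lift x) (F := f ∘ proj) (G := frameCoeff ψ ∘ proj)
        ((hF.contDiffAt Filter.univ_mem).differentiableAt (by simp))
        ((hg'.contDiffAt (hnhds x hx)).differentiableAt (by simp))
        (by simpa [proj_lift] using hg0 x hx) k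
      simp only [Function.comp_apply, proj_lift] at e4
      have e5 : q ∘ proj = fun y => f (proj y) * (frameCoeff ψ (proj y) ^ k)⁻¹ := rfl
      rw [e5, e4, e4] at e1
      refine e1.trans (Eq.trans ?_ (congrArg₂ (fun a b => (frameCoeff ψ x ^ k)⁻¹ * (a -
        k * f x * ((frameCoeff ψ x)⁻¹ * b))) e3 e2).symm)
      ring
    have h3 := hf.2 x v
    have h4 : dbarFun (fibreJ t) q x v + q x * (k * ((frameCoeff ψ x)⁻¹ *
        (dbarFun (fibreJ t) (frameCoeff ψ) x v +
          frameCoeff ψ x * dbarConst t * starRingEnd ℂ (φ₁ v)))) = 0 := by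
      have h5 : (frameCoeff ψ x)⁻¹ * frameCoeff ψ x = 1 := inv_mul_cancel₀ (hg0 x hx)
      rw [h2, hq]
      linear_combination (frameCoeff ψ x ^ k)⁻¹ * h3 + f x * (frameCoeff ψ x ^ k)⁻¹ * k *
        dbarConst t * starRingEnd ℂ (φ₁ v) * h5
    rw [h4, zero_smul]

/-! ### The equation `∂̄σ = 0` -/

/-- Liouville's theorem along a plane spanned by `u` and `v`, with the complex structure that maps
`u` to `v`. -/
theorem apply_add_eq_of_bounded {E : Type*} [NormedAddCommGroup E] [NormedSpace ℝ E] {F : E → ℂ}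
    (hF : Differentiable ℝ F) (hb : Bornology.IsBounded (range F)) {p u v : E}
    (huv : ∀ a b : ℝ, fderiv ℝ F (p + a • u + b • v) v =
      Complex.I * fderiv ℝ F (p + a • u + b • v) u) (a b : ℝ) :
    F (p + a • u + b • v) = F p := by
  set h : ℂ → ℂ := fun z => F (p + z.re • u + z.im • v) with hh
  have hd : ∀ z, HasFDerivAt h ((fderiv ℝ F (p + z.re • u + z.im • v)).comp
      (Complex.reCLM.smulRight u + Complex.imCLM.smulRight v)) z := by
    intro z
    have h1 : HasFDerivAt (fun z : ℂ => p + z.re • u + z.im • v)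
        (Complex.reCLM.smulRight u + Complex.imCLM.smulRight v) z :=
      ((Complex.reCLM.hasFDerivAt.smul_const u).const_add p).add
        (Complex.imCLM.hasFDerivAt.smul_const v)
    exact (hF _).hasFDerivAt.comp z h1
  have hc : Differentiable ℂ h := by
    intro z
    -- The remaining goal is the Cauchy–Riemann equation, which is `huv`.
    refine differentiableAt_complex_iff_differentiableAt_real.2 ⟨(hd z).differentiableAt, ?_⟩
    rw [(hd z).fderiv]
    simpa using huv z.re z.im
  have h2 := hc.apply_eq_apply_of_bounded (hb.subset (by rintro _ ⟨z, rfl⟩; exact ⟨_, rfl⟩))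
    ⟨a, b⟩ 0
  simpa [hh] using h2

theorem coordJ_field_zero (t : ℂ) (p : Fin 4 → ℝ) : coordJ t p (field 0 p) = field 1 p := by
  funext i
  fin_cases i <;> simp [coordJ, field]

theorem coordJ_congr {t : ℂ} {p q v : Fin 4 → ℝ} (h : p 0 = q 0) :
    coordJ t p v = coordJ t q v := by
  simp [coordJ, h]

section

variable {t : Δ} {k : ℕ} {f : KT → ℂ}

theorem IsSolution.differentiable (hf : IsSolution t k f) : Differentiable ℝ (f ∘ proj) :=
  (hf.1.comp contMDiff_proj).contDiff.differentiable (by simp)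

theorem IsSolution.isBounded_range (hf : IsSolution t k f) :
    Bornology.IsBounded (range (f ∘ proj)) :=
  (isCompact_range hf.1.continuous).isBounded.subset (range_comp_subset_range _ _)

theorem IsSolution.fderiv_eq (hf : IsSolution t k f) (p v : Fin 4 → ℝ) :
    fderiv ℝ (f ∘ proj) p v + Complex.I * fderiv ℝ (f ∘ proj) p (coordJ t p v) +
      2 * k * dbarConst t * starRingEnd ℂ (φ₁ v) * (f ∘ proj) p = 0 := by
  have h1 := hf.2 (proj p) (dproj p v)
  have h2 := dbarFun_dproj t (hf.1.contMDiffAt.mdifferentiableAt (x := proj p) (by simp)) v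
  rw [φ₁_dproj] at h1
  have h3 := (congrArg (fun z => z + k * (dbarConst t * starRingEnd ℂ (φ₁ v)) * f (proj p))
    h2).symm.trans h1
  simp only [Function.comp_apply]
  linear_combination 2 * h3

/-- Since φ₁ vanishes on e₃, the equation in that direction has no zeroth order term, and Liouville
applies on the plane of e₃ and Je₃, which is the (y, z)-plane. -/
theorem IsSolution.apply_eq_of_yz (hf : IsSolution t k f) (p : Fin 4 → ℝ) :
    (f ∘ proj) p = (f ∘ proj) ![p 0, 0, 0, p 3] := by
  have hre := (Δ_re_pos t).ne'
  set p' : Fin 4 → ℝ := ![p 0, 0, 0, p 3]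
  have h := apply_add_eq_of_bounded hf.differentiable hf.isBounded_range (p := p')
    (u := field 2 p') (v := coordJ t p' (field 2 p')) (fun a b => by
      have h1 := hf.fderiv_eq (p' + a • field 2 p' + b • coordJ t p' (field 2 p')) (field 2 p')
      have h2 : φ₁ (field 2 p') = 0 := by simp [φ₁_apply, field_two_coords]
      -- Neither e₃ nor Je₃ changes x, and J depends on the point only through x, so both directions
      -- are constant on the plane.
      have h3 : coordJ t (p' + a • field 2 p' + b • coordJ t p' (field 2 p')) (field 2 p') =
          coordJ t p' (field 2 p') :=
        coordJ_congr (by simp [coordJ, field]; rfl)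
      rw [h2, h3] at h1
      simp only [map_zero, mul_zero, zero_mul, add_zero] at h1
      linear_combination (-Complex.I) * h1 + Complex.I_mul_I *
        fderiv ℝ (f ∘ proj) (p' + a • field 2 p' + b • coordJ t p' (field 2 p'))
          (coordJ t p' (field 2 p')))
    -- The coefficients of p - p' in the basis e₃, Je₃, obtained from Je₃ = (-Im t e₃ + e₄)/(Re t +
    -- π).
    (p 1 + (t : ℂ).im * (p 2 - p 0 * p 1)) (((t : ℂ).re + Real.pi) * (p 2 - p 0 * p 1))
  rw [← h]
  congr 1
  funext i
  fin_cases i <;> simp [p', coordJ, field_two_coords]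
  all_goals field_simp
  all_goals ring

/-- The function `exp (2 i k c x)` on `G`. -/
noncomputable def expFun (t : ℂ) (k : ℕ) (p : Fin 4 → ℝ) : ℂ :=
  Complex.exp (2 * k * dbarConst t * p 0 * Complex.I)

theorem hasFDerivAt_exp_coord (c : ℂ) (p : Fin 4 → ℝ) :
    HasFDerivAt (fun q : Fin 4 → ℝ => Complex.exp (c * q 0))
      ((ContinuousLinearMap.proj (R := ℝ) (φ := fun _ : Fin 4 => ℝ) 0).smulRight
        (c * Complex.exp (c * p 0))) p := by
  have h1 : HasFDerivAt (fun q : Fin 4 → ℝ => c * (q 0 : ℂ)) ((ContinuousLinearMap.proj (R := ℝ)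
      (φ := fun _ : Fin 4 => ℝ) 0).smulRight c) p := by
    have h2 := (hasFDerivAt_apply (𝕜 := ℝ) (F' := fun _ : Fin 4 => ℝ) 0 p).smul_const c
    simpa [mul_comm] using h2
  have h3 := h1.cexp
  refine h3.congr_fderiv ?_
  ext v
  simp
  ring

theorem IsSolution.apply_eq (hf : IsSolution t k f) (p : Fin 4 → ℝ) :
    f (proj p) = f (proj 0) * expFun t k p := by
  -- The factor exp(c x) removes the zeroth order term of the equation along e₁. It has modulus 1
  -- because `dbarConst` is real, so the product stays bounded.
  set c : ℂ := -(2 * k * dbarConst t * Complex.I) with hc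
  set H : (Fin 4 → ℝ) → ℂ := fun q => (f ∘ proj) q * Complex.exp (c * q 0) with hH
  have hHd : ∀ q v, fderiv ℝ H q v = (fderiv ℝ (f ∘ proj) q v + c * v 0 * (f ∘ proj) q) *
      Complex.exp (c * q 0) := by
    intro q v
    refine (DFunLike.congr_fun
      ((hf.differentiable q).hasFDerivAt.mul (hasFDerivAt_exp_coord c q)).fderiv v).trans ?_
    simp
    ring
  have hdiff : Differentiable ℝ H := fun q =>
    (hf.differentiable q).mul (hasFDerivAt_exp_coord c q).differentiableAt
  have hnorm : ∀ q, ‖H q‖ = ‖(f ∘ proj) q‖ := by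
    intro q
    rw [hH, norm_mul, Complex.norm_exp]
    simp [hc]
  have hb : Bornology.IsBounded (range H) := by
    obtain ⟨C, hC⟩ := hf.isBounded_range.exists_norm_le
    refine isBounded_iff_forall_norm_le.2 ⟨C, ?_⟩
    rintro _ ⟨q, rfl⟩
    rw [hnorm]
    exact hC _ ⟨q, rfl⟩
  have h := apply_add_eq_of_bounded hdiff hb (p := 0) (u := field 0 0) (v := field 1 0)
    (fun a b => by
      have h1 := hf.fderiv_eq (0 + a • field 0 0 + b • field 1 0) (field 0 0)
      have h2 : φ₁ (field 0 0) = 1 := by simp [φ₁_apply, field_zero_coords]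
      have h3 := coordJ_field_zero t (0 + a • field 0 0 + b • field 1 0)
      change coordJ t _ (field 0 0) = field 1 0 at h3
      rw [h2, h3, map_one] at h1
      rw [hHd, hHd]
      have h6 : (field 0 0 0 : ℂ) = 0 := by simp [field]
      have h7 : (field 1 0 0 : ℂ) = 1 := by simp [field]
      rw [h6, h7, hc]
      generalize (0 : Fin 4 → ℝ) + a • field 0 0 + b • field 1 0 = q at h1 ⊢
      linear_combination (-Complex.I * Complex.exp (-(2 * k * dbarConst t * Complex.I) * q 0)) *
        h1 + Complex.exp (-(2 * k * dbarConst t * Complex.I) * q 0) *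
          fderiv ℝ (f ∘ proj) q (field 1 0) * Complex.I_mul_I) (p 3) (p 0)
  have h4 : (0 : Fin 4 → ℝ) + p 3 • field 0 0 + p 0 • field 1 0 = ![p 0, 0, 0, p 3] := by
    funext i
    fin_cases i <;> simp [field]
  rw [h4, hH] at h
  have h5 := hf.apply_eq_of_yz p
  simp only [Function.comp_apply] at h h5
  rw [h5, expFun]
  simp at h
  rw [← h, mul_assoc, ← Complex.exp_add, hc]
  ring_nf
  simp

end

/-! ### The plurigenera and the Kodaira dimension of the fibres -/

/-- The condition on `t` and `k` under which the fibre over `t` has a nonzero `k`-canonical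
section. -/
def IsResonant (t : ℂ) (k : ℕ) : Prop := ∃ n : ℤ, k * dbarConst t = n * Real.pi

theorem expFun_ne_zero (t : ℂ) (k : ℕ) (p : Fin 4 → ℝ) : expFun t k p ≠ 0 := Complex.exp_ne_zero _

/-- A lattice translation changes x by an integer j, hence the exponent by 2πi n j. -/
theorem expFun_lift_proj {t : ℂ} {k : ℕ} (h : IsResonant t k) (p : Fin 4 → ℝ) :
    expFun t k (lift (proj p)) = expFun t k p := by
  obtain ⟨n, hn⟩ := h
  obtain ⟨j, hj, -⟩ := exists_dproj_eq p
  have h0 : p 0 = j 0 + lift (proj p) 0 := by conv_lhs => rw [hj]; simp [coordMul]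
  have hn' : (k * dbarConst t : ℂ) = n * Real.pi := by exact_mod_cast hn
  rw [expFun, expFun, h0, Complex.exp_eq_exp_iff_exists_int]
  refine ⟨-(n * j 0), ?_⟩
  push_cast
  linear_combination (-2 * (j 0 : ℂ) * Complex.I) * hn'

/-- The points x = 0 and x = 1 of the x-axis have the same image, which forces exp(2ikc) = 1. -/
theorem IsSolution.isResonant {t : Δ} {k : ℕ} {f : KT → ℂ} (hf : IsSolution t k f)
    (h0 : f (proj 0) ≠ 0) : IsResonant t k := by
  have h1 := hf.apply_eq ![1, 0, 0, 0]
  have h2 : proj ![1, 0, 0, 0] = proj 0 := by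
    rw [proj_eq_iff_mem_range_intCast]
    exact ⟨⟨1, by simp⟩, ⟨0, by simp⟩, ⟨0, by simp⟩, ⟨0, by simp⟩⟩
  rw [h2] at h1
  have h3 : expFun t k ![1, 0, 0, 0] = 1 := (mul_right_eq_self₀.1 h1.symm).resolve_right h0
  rw [expFun, Complex.exp_eq_one_iff] at h3
  obtain ⟨n, hn⟩ := h3
  refine ⟨n, ?_⟩
  have h4 : (2 * Complex.I) * (k * dbarConst t : ℂ) = (2 * Complex.I) * (n * Real.pi) := by
    simp at hn
    linear_combination hn
  have h5 := mul_left_cancel₀ (by simp) h4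
  exact_mod_cast h5

theorem isSolution_expFun {t : Δ} {k : ℕ} (h : IsResonant t k) :
    IsSolution t k fun x => expFun t k (lift x) := by
  have h1 : (fun x => expFun t k (lift x)) ∘ proj =
      fun q => Complex.exp (2 * k * dbarConst t * Complex.I * q 0) := by
    funext q
    rw [Function.comp_apply, expFun_lift_proj h, expFun]
    ring_nf
  have h2 : ContMDiff 𝓘(ℝ, Fin 4 → ℝ) 𝓘(ℝ, ℂ) ∞ fun x => expFun t k (lift x) := by
    intro x
    refine contMDiffAt_of_contDiffAt_comp_proj ?_
    rw [h1]
    have h3 : ContDiff ℝ ∞ fun q : Fin 4 → ℝ => ((q 0 : ℝ) : ℂ) :=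
      Complex.ofRealCLM.contDiff.comp (contDiff_apply ℝ ℝ (0 : Fin 4))
    exact (contDiff_const.mul h3).cexp.contDiffAt
  refine ⟨h2, fun x v => ?_⟩
  have h4 := dbarFun_eq t (h2.contMDiffAt.mdifferentiableAt (x := x) (by simp)) v
  have h5 := (hasFDerivAt_exp_coord (2 * k * dbarConst t * Complex.I) (lift x)).fderiv
  rw [h1, h5] at h4
  have h6 : starRingEnd ℂ (φ₁ v) = v 3 - Complex.I * v 0 := by
    rw [φ₁_apply]
    simp
    ring
  have h7 : coordJ t (lift x) v 0 = v 3 := rfl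
  rw [h4, h6]
  simp only [expFun]
  simp [h7]
  ring_nf
  simp

theorem pluricanonicalSections_eq_bot {t : Δ} {k : ℕ} (h : ¬ IsResonant t k) :
    pluricanonicalSections (fibreJ t) 2 k = ⊥ := by
  refine (Submodule.eq_bot_iff _).2 fun σ hσ => ?_
  obtain ⟨f, hf, hσf⟩ := exists_isSolution_of_mem hσ
  have h0 : f (proj 0) = 0 := by
    by_contra h0
    exact h (hf.isResonant h0)
  funext x
  rw [hσf]
  have h1 := hf.apply_eq (lift x)
  rw [h0, zero_mul, proj_lift] at h1
  rw [h1]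
  exact zero_smul ℂ (formPow k (canonicalSection t) x)

/-- The `k`-canonical section that generates the space of all of them in the resonant case. -/
noncomputable def expSection (t : Δ) (k : ℕ) (x : KT) : TensorFibre (Fin 4 → ℝ) 2 k x :=
  expFun t k (lift x) • formPow k (canonicalSection t) x

theorem smul_expSection_injective (t : Δ) (k : ℕ) :
    Function.Injective fun c : ℂ => c • expSection t k := by
  intro c d h
  have h1 : c • expSection t k (proj 0) = d • expSection t k (proj 0) := congrFun h (proj 0)
  rw [expSection, smul_smul, smul_smul] at h1
  have h2 := smul_left_injective ℂ (formPow_canonicalSection_ne_zero t k (proj 0)) h1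
  exact mul_right_cancel₀ (expFun_ne_zero t k _) h2

theorem pluricanonicalSections_eq_span {t : Δ} {k : ℕ} (h : IsResonant t k) :
    pluricanonicalSections (fibreJ t) 2 k = Submodule.span ℂ {expSection t k} := by
  refine le_antisymm (fun σ hσ => ?_) ?_
  · obtain ⟨f, hf, hσf⟩ := exists_isSolution_of_mem hσ
    refine Submodule.mem_span_singleton.2 ⟨f (proj 0), ?_⟩
    funext x
    have h1 := hf.apply_eq (lift x)
    rw [proj_lift] at h1
    rw [hσf, h1, mul_smul]
    rfl
  · rw [Submodule.span_singleton_le_iff_mem]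
    exact mem_of_isSolution (isSolution_expFun h)

theorem finite_pluricanonicalSections (t : Δ) (k : ℕ) :
    Module.Finite ℂ (pluricanonicalSections (fibreJ t) 2 k) := by
  by_cases h : IsResonant t k
  · rw [pluricanonicalSections_eq_span h]
    infer_instance
  · rw [pluricanonicalSections_eq_bot h]
    infer_instance

theorem fibrePlurigenus_of_isResonant {t : Δ} {k : ℕ} (h : IsResonant t k) :
    fibrePlurigenus k t = 1 := by
  rw [fibrePlurigenus, plurigenus, pluricanonicalSections_eq_span h]
  have h1 : Function.Bijective (LinearMap.toSpanSingleton ℂ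
      (Submodule.span ℂ {expSection t k}) ⟨_, Submodule.mem_span_singleton_self _⟩) := by
    refine ⟨fun c d hcd => smul_expSection_injective t k (congrArg Subtype.val hcd), ?_⟩
    rintro ⟨σ, hσ⟩
    obtain ⟨c, rfl⟩ := Submodule.mem_span_singleton.1 hσ
    exact ⟨c, rfl⟩
  rw [← (LinearEquiv.ofBijective _ h1).finrank_eq, Module.finrank_self]

theorem fibrePlurigenus_of_not_isResonant {t : Δ} {k : ℕ} (h : ¬ IsResonant t k) :
    fibrePlurigenus k t = 0 := by
  rw [fibrePlurigenus, plurigenus, pluricanonicalSections_eq_bot h, finrank_bot]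

/-- It is the preimage of the closed set ℤ under the continuous function kc/π. -/
theorem isClosed_setOf_isResonant (k : ℕ) : IsClosed {t : Δ | IsResonant t k} := by
  have h1 : Continuous fun t : Δ => k * dbarConst t / Real.pi := by
    unfold dbarConst
    have hre : Continuous fun t : Δ => (t : ℂ).re := Complex.continuous_re.comp continuous_subtype_val
    have hn : Continuous fun t : Δ => ‖(t : ℂ) + Real.pi‖ :=
      (continuous_subtype_val.add continuous_const).norm
    refine (continuous_const.mul ((hn.pow 2).div (continuous_const.mul (hre.add continuous_const))
      fun t => ?_)).div_const _
    exact (mul_pos four_pos (Δ_re_pos t)).ne'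
  convert Real.isClosed_range_intCast.preimage h1 using 1
  ext t
  simp only [mem_ofPred_eq, mem_preimage, mem_range, IsResonant, eq_div_iff Real.pi_ne_zero]
  exact exists_congr fun n => eq_comm

theorem upperSemicontinuous_fibrePlurigenus (k : ℕ) :
    UpperSemicontinuous (fibrePlurigenus k) := by
  intro t y hy
  by_cases h : IsResonant t k
  · rw [fibrePlurigenus_of_isResonant h] at hy
    refine Filter.Eventually.of_forall fun s => ?_
    change fibrePlurigenus k s < y
    by_cases hs : IsResonant s k
    · rwa [fibrePlurigenus_of_isResonant hs]
    · rw [fibrePlurigenus_of_not_isResonant hs]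
      omega
  · filter_upwards [(isClosed_setOf_isResonant k).isOpen_compl.mem_nhds h] with s hs
    rw [fibrePlurigenus_of_not_isResonant h] at hy
    change fibrePlurigenus k s < y
    rwa [fibrePlurigenus_of_not_isResonant hs]

/-! ### Real parameters -/

theorem isResonant_realPoint_iff (s : Ioo (-Real.pi) Real.pi) (k : ℕ) :
    IsResonant (realPoint s) k ↔ ∃ n : ℤ, k * ((s : ℝ) + Real.pi) = 4 * n * Real.pi := by
  have h0 : (s : ℝ) + Real.pi ≠ 0 := by linarith [s.2.1]
  have h1 : dbarConst (realPoint s) = ((s : ℝ) + Real.pi) / 4 := by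
    rw [dbarConst, norm_add_pi_sq]
    simp [realPoint]
    field_simp
  refine exists_congr fun n => ?_
  rw [h1]
  constructor <;> intro h <;> linarith

theorem mem_piRat_of_isResonant {s : Ioo (-Real.pi) Real.pi} {k : ℕ} (hk : 1 ≤ k)
    (h : IsResonant (realPoint s) k) : (s : ℝ) ∈ piRat := by
  obtain ⟨n, hn⟩ := (isResonant_realPoint_iff s k).1 h
  have hk' : (k : ℝ) ≠ 0 := by positivity
  -- Solves k (s + π) = 4nπ for s/π.
  refine ⟨4 * n / k - 1, ?_⟩
  push_cast
  field_simp
  linarith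

theorem isResonant_of_eq_pi_mul {s : Ioo (-Real.pi) Real.pi} {q : ℚ} (hq : (s : ℝ) = Real.pi * q)
    (j : ℕ) : IsResonant (realPoint s) (4 * q.den * j) := by
  rw [isResonant_realPoint_iff]
  -- From s + π = π (q.num + q.den)/q.den; the factor 4 in the index absorbs the one in c = (s +
  -- π)/4.
  refine ⟨j * (q.num + q.den), ?_⟩
  have h1 : (q.den : ℝ) * q = q.num := by exact_mod_cast Rat.den_mul_eq_num q
  rw [hq]
  push_cast
  linear_combination (4 * (j : ℝ) * Real.pi) * h1

theorem fibreKod_of_notMem_piRat {s : Ioo (-Real.pi) Real.pi} (hs : (s : ℝ) ∉ piRat) :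
    fibreKod (realPoint s) = ⊥ := by
  rw [fibreKod, kodairaDim, if_pos]
  intro m hm
  exact fibrePlurigenus_of_not_isResonant fun h => hs (mem_piRat_of_isResonant hm h)

theorem fibreKod_of_mem_piRat {s : Ioo (-Real.pi) Real.pi} (hs : (s : ℝ) ∈ piRat) :
    fibreKod (realPoint s) = 0 := by
  obtain ⟨q, hq⟩ := hs
  have hres := isResonant_of_eq_pi_mul hq
  have h1 : ∀ m, IsResonant (realPoint s) m → plurigenus (fibreJ (realPoint s)) 2 m = 1 :=
    fun m hm => fibrePlurigenus_of_isResonant hm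
  have h0 : ∀ m, ¬ IsResonant (realPoint s) m → plurigenus (fibreJ (realPoint s)) 2 m = 0 :=
    fun m hm => fibrePlurigenus_of_not_isResonant hm
  rw [fibreKod, kodairaDim, if_neg]
  · refine le_antisymm ?_ ?_
    · refine Filter.limsup_le_of_le (by isBoundedDefault) ?_
      -- From 2 on log m is positive, so a vanishing plurigenus gives log 0 / log m = -∞, while a
      -- plurigenus equal to 1 gives 0.
      filter_upwards [Filter.eventually_ge_atTop 2] with m hm
      by_cases h : IsResonant (realPoint s) m
      · simp [h1 m h]
      · have hlog : 0 < Real.log m := Real.log_pos (by exact_mod_cast hm)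
        rw [h0 m h, Nat.cast_zero, ENNReal.log_zero,
          EReal.bot_div_of_pos_ne_top (by exact_mod_cast hlog) (EReal.coe_ne_top _)]
        exact bot_le
    · refine Filter.le_limsup_of_frequently_le ?_ (by isBoundedDefault)
      -- The multiples of 4 q.den are resonant, so the value 0 occurs for arbitrarily large indices.
      refine Filter.frequently_atTop.2 fun m => ⟨4 * q.den * m, ?_, ?_⟩
      · nlinarith [q.den_pos]
      · simp [h1 _ (hres m)]
  · intro h
    have h2 := h (4 * q.den * 1) (by have := q.den_pos; omega)
    rw [h1 _ (hres 1)] at h2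
    exact one_ne_zero h2

/-! ### Failure of semicontinuity of the Kodaira dimension -/

theorem exists_mem_of_dense_of_eventually {s : Ioo (-Real.pi) Real.pi} {D : Set ℝ} (hD : Dense D)
    {P : Ioo (-Real.pi) Real.pi → Prop} (hP : ∀ᶠ r in 𝓝 s, P r) : ∃ r, P r ∧ (r : ℝ) ∈ D := by
  have h1 : Subtype.val '' {r | P r} ∈ 𝓝 (s : ℝ) := by
    rw [← isOpen_Ioo.isOpenEmbedding_subtypeVal.map_nhds_eq s]
    exact Filter.image_mem_map hP
  obtain ⟨_, hrD, r, hr, rfl⟩ := hD.inter_nhds_nonempty h1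
  exact ⟨r, hr, hrD⟩

theorem piRat_eq_range : piRat = range fun q : ℚ => Real.pi * (q : ℝ) := by
  ext x
  exact exists_congr fun q => eq_comm

theorem dense_piRat : Dense piRat := by
  rw [piRat_eq_range]
  exact (mul_left_surjective₀ Real.pi_ne_zero).denseRange.comp Rat.denseRange_cast (by fun_prop)

theorem dense_compl_piRat : Dense piRatᶜ := by
  rw [piRat_eq_range]
  exact (countable_range _).dense_compl ℝ

theorem not_upperSemicontinuousAt {s : Ioo (-Real.pi) Real.pi} (hs : (s : ℝ) ∉ piRat) :
    ¬ UpperSemicontinuousAt (fun r => fibreKod (realPoint r)) s := by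
  intro h
  -- Upper semicontinuity at a point with value -∞ would keep nearby values below 0, but nearby
  -- points of πℚ have value 0.
  have h1 := h 0 (by simp [fibreKod_of_notMem_piRat hs])
  obtain ⟨r, hr, hrD⟩ := exists_mem_of_dense_of_eventually dense_piRat h1
  exact lt_irrefl _ ((fibreKod_of_mem_piRat hrD).symm.trans_lt hr)

theorem not_lowerSemicontinuousAt {s : Ioo (-Real.pi) Real.pi} (hs : (s : ℝ) ∈ piRat) :
    ¬ LowerSemicontinuousAt (fun r => fibreKod (realPoint r)) s := by
  intro h
  have h1 := h ⊥ (by simp [fibreKod_of_mem_piRat hs])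
  obtain ⟨r, hr, hrD⟩ := exists_mem_of_dense_of_eventually dense_compl_piRat h1
  exact lt_irrefl _ (hr.trans_eq (fibreKod_of_notMem_piRat hrD))

theorem continuous_realPoint : Continuous realPoint :=
  Continuous.subtype_mk (Complex.continuous_ofReal.comp continuous_subtype_val) _

theorem not_upperSemicontinuous_fibreKod : ¬ UpperSemicontinuous fibreKod := by
  intro h
  -- A trivial property, used only to extract from density some point of the interval outside πℚ.
  have h1 : ∀ᶠ r : Ioo (-Real.pi) Real.pi in 𝓝 ⟨0, by simp [Real.pi_pos]⟩, True :=
    Filter.Eventually.of_forall fun _ => trivial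
  obtain ⟨s, -, hs⟩ := exists_mem_of_dense_of_eventually dense_compl_piRat h1
  exact not_upperSemicontinuousAt hs
    fun y hy => continuous_realPoint.continuousAt.eventually (h _ y hy)

theorem not_lowerSemicontinuous_fibreKod : ¬ LowerSemicontinuous fibreKod := by
  intro h
  exact not_lowerSemicontinuousAt (s := ⟨0, by simp [Real.pi_pos]⟩) ⟨0, by simp⟩
    fun y hy => continuous_realPoint.continuousAt.eventually (h _ y hy)

end KodairaThurston

theorem mainTheorem1 :
    -- `M` is compact and Hausdorff, and the fields `e₁, …, e₄` descend to `M`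
    (CompactSpace KodairaThurston.KT ∧ T2Space KodairaThurston.KT ∧
      ContMDiff 𝓘(ℝ, Fin 4 → ℝ) 𝓘(ℝ, Fin 4 → ℝ) ∞ KodairaThurston.proj ∧
      ∀ (p : Fin 4 → ℝ) (i : Fin 4),
        mfderiv 𝓘(ℝ, Fin 4 → ℝ) 𝓘(ℝ, Fin 4 → ℝ) KodairaThurston.proj p
          (KodairaThurston.field i p) = KodairaThurston.frame i (KodairaThurston.proj p)) ∧
    -- `J` is an almost complex structure on `M × Δ` and the projection is pseudoholomorphic
    AlmostComplex.IsAlmostComplexStructure (𝓘(ℝ, Fin 4 → ℝ).prod 𝓘(ℝ, ℂ))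
      KodairaThurston.totalJ ∧
    AlmostComplex.IsPseudoholomorphic (𝓘(ℝ, Fin 4 → ℝ).prod 𝓘(ℝ, ℂ)) 𝓘(ℝ, ℂ)
      KodairaThurston.totalJ KodairaThurston.stdJ
      (Prod.snd : KodairaThurston.KT × KodairaThurston.Δ → KodairaThurston.Δ) ∧
    -- every fibre `M_t` is an almost complex submanifold, by means of `J_t`
    (∀ t : KodairaThurston.Δ,
      AlmostComplex.IsAlmostComplexStructure 𝓘(ℝ, Fin 4 → ℝ) (KodairaThurston.fibreJ t) ∧
      AlmostComplex.IsPseudoholomorphic 𝓘(ℝ, Fin 4 → ℝ) (𝓘(ℝ, Fin 4 → ℝ).prod 𝓘(ℝ, ℂ))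
        (KodairaThurston.fibreJ t) KodairaThurston.totalJ (KodairaThurston.fibreIncl t)) ∧
    -- the Kodaira dimension of the fibres over real `t`
    (∀ s : Ioo (-Real.pi) Real.pi,
      ((s : ℝ) ∉ KodairaThurston.piRat →
        KodairaThurston.fibreKod (KodairaThurston.realPoint s) = ⊥) ∧
      ((s : ℝ) ∈ KodairaThurston.piRat →
        KodairaThurston.fibreKod (KodairaThurston.realPoint s) = 0)) ∧
    -- each plurigenus is (finite and) upper semicontinuous on `Δ`
    (∀ m : ℕ, 1 ≤ m →
      (∀ t : KodairaThurston.Δ, Module.Finite ℂ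
        (AlmostComplex.pluricanonicalSections (KodairaThurston.fibreJ t) 2 m)) ∧
      UpperSemicontinuous (KodairaThurston.fibrePlurigenus m)) ∧
    -- the Kodaira dimension is not semicontinuous
    (¬ UpperSemicontinuous KodairaThurston.fibreKod ∧
      ¬ LowerSemicontinuous KodairaThurston.fibreKod) ∧
    (∀ s : Ioo (-Real.pi) Real.pi,
      ((s : ℝ) ∉ KodairaThurston.piRat → ¬ UpperSemicontinuousAt
        (fun r => KodairaThurston.fibreKod (KodairaThurston.realPoint r)) s) ∧
      ((s : ℝ) ∈ KodairaThurston.piRat → ¬ LowerSemicontinuousAt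
        (fun r => KodairaThurston.fibreKod (KodairaThurston.realPoint r)) s)) := by
  open KodairaThurston in
  refine ⟨⟨inferInstance, inferInstance, contMDiff_proj, mfderiv_proj_field⟩,
    isAlmostComplexStructure_totalJ, isPseudoholomorphic_snd,
    fun t => ⟨isAlmostComplexStructure_fibreJ t, isPseudoholomorphic_fibreIncl t⟩,
    fun s => ⟨fibreKod_of_notMem_piRat, fibreKod_of_mem_piRat⟩,
    fun k _ => ⟨fun t => finite_pluricanonicalSections t k,
      upperSemicontinuous_fibrePlurigenus k⟩,
    ⟨not_upperSemicontinuous_fibreKod, not_lowerSemicontinuous_fibreKod⟩,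
    fun s => ⟨not_upperSemicontinuousAt, not_lowerSemicontinuousAt⟩⟩
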